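/- Partitions are identified with their Young diagrams (English notation). For a partition $\lambda=(\lambda_1,\lambda_2,\dots,\lambda_t)$ let $\lambda^*=(\lambda_2,\dots,\lambda_t)$. Let $k\ge 0$ and let $\boldsymbol i=(i_1,\dots,i_k)$ be a sequence of positive integers. For $m\ge\max_j i_j$, let $T_m^{(0)}$ be the one-row standard Young tableau with entries $1,2,\dots,m$, and for $j=0,1,\dots,k-1$ let $T_m^{(j+\frac12)}$ be obtained from $T_m^{(j)}$ by removing the entry $i_{j+1}$ by jeu de taquin (exchange its box repeatedly with the right or lower neighbour having the smaller entry until it is a corner, then delete it), and let $T_m^{(j+1)}$ be obtained from $T_m^{(j+\frac12)}$ by RSK row insertion of $i_{j+1}$. Let $P_m^*(\boldsymbol i)$ be the sequence $\big((\operatorname{shape}T_m^{(j)})^*: j=0,\frac12,1,1\frac12,\dots,k\big)$. The limiting vacillating tableau $P^*(\boldsymbol i)$ of $\boldsymbol i$ is the sequence of partitions that equals $P_m^*(\boldsymbol i)$ for all $n,m$ with $\boldsymbol i\in\{1,\dots,n\}^k$ and $m>n+2k$. Proposition. The limiting vacillating tableau $P^*(\boldsymbol i)$ is well defined for every sequence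 $\boldsymbol i$ of $k$ positive integers. A sequence of integer partitions $(\lambda^{(0)},\lambda^{(\frac12)},\lambda^{(1)},\dots,\lambda^{(k)})$ is the limiting vacillating tableau of some sequence of $k$ positive integers if and only if $\lambda^{(0)}=\emptyset$ and, for each integer $j=0,1,\dots,k-1$, (a) $\lambda^{(j+\frac12)}$ is obtained from $\lambda^{(j)}$ by either doing nothing or deleting a box; (b) $\lambda^{(j+1)}$ is obtained from $\lambda^{(j+\frac12)}$ by adding a box. -/

import Mathlib

namespace Vacillating

/-- A filling of a left-justified array of boxes, given by its rows from top to bottom (English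
notation). Partial tableaux are the fillings by distinct integers, increasing along rows and
columns, with nonempty rows of weakly decreasing lengths. -/
abbrev Filling := List (List ℕ)

/-- The shape of a tableau: the list of its row lengths `(λ₁, λ₂, …, λ_t)`. -/
def shape (T : Filling) : List ℕ := T.map List.length

/-- RSK row insertion of `x`, starting in the first row of the given list of rows. If some entry
of the row exceeds `x`, the smallest such entry `y` is replaced by `x` and `y` is inserted into
the remaining rows; otherwise `x` is placed at the end of the (possibly empty) row. -/
def rskInsert (x : ℕ) : Filling → Filling
  | [] => [[x]]
  | R :: Rs =>
    match (R.filter (fun z => x < z)).min? with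
    | none => (R ++ [x]) :: Rs
    | some y => R.map (fun z => if z = y then x else z) :: rskInsert y Rs

/-- The sliding loop of jeu de taquin for a box `c` which is to be removed. The row of `c` is
`l ++ [c] ++ r`, and `Bs` are the rows below it; the result consists of the row of `c` and the rows
below it after the process. While `c` is not a corner, it is exchanged with the right or the lower
neighbour, whichever has the smaller entry (or is the only one to exist). When `c` is a corner it
is deleted, and so is its row if nothing else is left in it. -/
def jdtSlide (l r : List ℕ) (Bs : Filling) : Filling :=
  match r, Bs with
  | [], [] => if l = [] then [] else [l]
  | a :: r', [] => jdtSlide (l ++ [a]) r' []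
  | [], B :: Bs' =>
    match B[l.length]? with
    | none => if l = [] then B :: Bs' else l :: B :: Bs'
    | some b => (l ++ [b]) :: jdtSlide (B.take l.length) (B.drop (l.length + 1)) Bs'
  | a :: r', B :: Bs' =>
    match B[l.length]? with
    | none => jdtSlide (l ++ [a]) r' (B :: Bs')
    | some b =>
      if a < b then jdtSlide (l ++ [a]) r' (B :: Bs')
      else (l ++ b :: a :: r') :: jdtSlide (B.take l.length) (B.drop (l.length + 1)) Bs'
termination_by (Bs.length, r.length)

/-- Jeu de taquin removal of the entry `x` from a tableau containing it: locate the box of `x`,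
then slide it out. -/
def jdtDelete (x : ℕ) : Filling → Filling
  | [] => []
  | R :: Rs =>
    if x ∈ R then jdtSlide (R.take (R.idxOf x)) (R.drop (R.idxOf x + 1)) Rs
    else R :: jdtDelete x Rs

/-- The delete-insert process of `DI_m^k` applied to `i = (i₁, …, i_k)` (`i j` is `i_{j+1}`):
`diTableau m i t` is the tableau `T^(t/2)`. It starts from the one-row tableau `1, 2, …, m`;
`T^(j+1/2)` is `T^(j)` with `i_{j+1}` removed by jeu de taquin, and `T^(j+1)` is `T^(j+1/2)` with
`i_{j+1}` inserted by RSK. (Only `t ≤ 2k` matters; the process is constant afterwards.) -/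
def diTableau (m : ℕ) {k : ℕ} (i : Fin k → ℕ+) : ℕ → Filling
  | 0 => [List.range' 1 m]
  | t + 1 =>
    if h : t / 2 < k then
      if t % 2 = 0 then jdtDelete (i ⟨t / 2, h⟩) (diTableau m i t)
      else rskInsert (i ⟨t / 2, h⟩) (diTableau m i t)
    else diTableau m i t

/-- The `m`-vacillating tableau of the sequence `i` under `DI_m^k`: the sequence of
shapes `λ^(0), λ^(1/2), …, λ^(k)`; position `t` holds `λ^(t/2)`. -/
def vacillatingTableau (m : ℕ) {k : ℕ} (i : Fin k → ℕ+) (t : Fin (2 * k + 1)) : List ℕ :=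
  shape (diTableau m i t)

/-- The simplified vacillating tableau: `λ = (λ₁, λ₂, …, λ_t)` is replaced throughout by
`λ* = (λ₂, …, λ_t)`. -/
def simplifiedTableau (m : ℕ) {k : ℕ} (i : Fin k → ℕ+) (t : Fin (2 * k + 1)) : List ℕ :=
  (vacillatingTableau m i t).tail

/-- `P` is the limiting vacillating tableau of the sequence `i` of positive integers: whenever
`i ∈ [n]^k` and `m > n + 2k`, the simplified `m`-vacillating tableau of `i` is `P`. Position `t` of
`P` holds `λ^(t/2)`; integer partitions are represented by Young diagrams, whose list of parts is
`YoungDiagram.rowLens`. -/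
def IsLimitingTableau {k : ℕ} (i : Fin k → ℕ+) (P : Fin (2 * k + 1) → YoungDiagram) : Prop :=
  ∀ n : ℕ, (∀ j, (i j : ℕ) ≤ n) → ∀ m : ℕ, n + 2 * k < m →
    ∀ t, (P t).rowLens = simplifiedTableau m i t

/-- `ν` is obtained from `μ` by adding a box (equivalently, `μ` from `ν` by deleting a box). -/
def AddsBox (μ ν : YoungDiagram) : Prop :=
  ∃ c, c ∉ μ.cells ∧ ν.cells = insert c μ.cells

end Vacillating

/-!
The tableaux of the delete-insert process are handled as lists of rows with the predicate `IsTab`,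
and the relation "add a box" as the inductive relation `AddsRow` on lists of row lengths.

*One step.* Removing an entry by jeu de taquin, respectively inserting a new one by row insertion,
turns a tableau into a tableau with the expected entries, and the shape loses, respectively gains,
a box (`jdtDelete_spec`, `rskInsert_spec`). In the middle of a slide, the objects are tableaux with
a hole (`IsHole`).

*Independence of `m`.* If the first row is longer than the second one at every removal, and every
insertion bumps an entry out of the first row, then passing from `m` to `m + 1` merely appends the
entry `m + 1` to the first row of every tableau (`Stable.di_succ`), so that the shapes below the
first row do not change. For `m > n + 2k` both conditions hold, because at most `k` boxes lie below
the first row (`stable_of_lt`). So the limiting tableau exists. That each insertion bumps an entry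
out of the first row also means that it adds a box to the shape below the first row, while
a removal deletes a box either there or from the first row; these are the conditions of
the criterion.

*Realizing a sequence of shapes.* Both kinds of steps are invertible: for every corner there are
a smaller tableau and an entry whose insertion adds this corner (`exists_rskInsert_eq`), and every
new entry can be slid in from every new corner (`exists_jdtDelete_eq`). Complete the given shapes by
first rows so long that the results are partitions of some fixed `m`, respectively of `m - 1` at the
half-integer positions. Starting from any standard tableau of the last shape and running the process
backwards along these shapes ends in the one-row tableau, and the entries met on the way form
a sequence with the prescribed shapes (`exists_di_eq`). The lengths of the first rows show that this
process satisfies the two conditions above (`exists_stable`), hence the prescribed shapes are those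
for all large `m`.
-/

namespace Vacillating

/-! ### Tableaux and shapes -/

/-- The row `B` may stand below the row `R` in a tableau: it is not longer, and each of its entries
exceeds the entry of `R` in the same column. -/
def Dom (R B : List ℕ) : Prop :=
  B.length ≤ R.length ∧ ∀ i (hB : i < B.length) (hR : i < R.length), R[i] < B[i]

/-- Partial tableaux: nonempty rows, increasing along rows and columns. Distinctness of the entries
is expressed separately by `T.flatten.Nodup`. -/
def IsTab : Filling → Prop
  | [] => True
  | R :: Rs => R ≠ [] ∧ R.Pairwise (· < ·) ∧ Dom R (Rs.headD []) ∧ IsTab Rs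

/-- `AddsRow μ ν`: one of the rows of the list `μ` of row lengths is prolonged by a box, or a row
with a single box is added at the end, and the result is `ν`. -/
inductive AddsRow : List ℕ → List ℕ → Prop
  | new : AddsRow [] [1]
  | here (a : ℕ) (μ : List ℕ) : AddsRow (a :: μ) ((a + 1) :: μ)
  | lower (a : ℕ) {μ ν : List ℕ} : AddsRow μ ν → AddsRow (a :: μ) (a :: ν)

theorem dom_nil (R : List ℕ) : Dom R [] := by simp [Dom]

/-! ### Row insertion -/

theorem filter_min_none {R : List ℕ} {x : ℕ} (h : ∀ z ∈ R, z < x) :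
    (R.filter (fun z => x < z)).min? = none := by
  rw [List.min?_eq_none_iff, List.filter_eq_nil_iff]
  intro z hz; simpa using (h z hz).le

theorem rskInsert_append {R : List ℕ} {x : ℕ} (h : ∀ z ∈ R, z < x) (Rs : Filling) :
    rskInsert x (R :: Rs) = (R ++ [x]) :: Rs := by
  rw [rskInsert, filter_min_none h]

theorem rskInsert_bump {u v : List ℕ} {x y : ℕ} (hs : (u ++ y :: v).Pairwise (· < ·))
    (hu : ∀ z ∈ u, z < x) (hxy : x < y) (Rs : Filling) :
    rskInsert x ((u ++ y :: v) :: Rs) = (u ++ x :: v) :: rskInsert y Rs := by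
  have hs' := List.pairwise_append.1 hs
  have hv := List.pairwise_cons.1 hs'.2.1
  have hmin : ((u ++ y :: v).filter (fun z => x < z)).min? = some y := by
    rw [List.min?_eq_some_iff]
    simp only [List.mem_filter, List.mem_append, List.mem_cons, decide_eq_true_eq]
    refine ⟨⟨by simp, hxy⟩, ?_⟩
    rintro z ⟨hz | hz | hz, hxz⟩
    · have := hu z hz; omega
    · omega
    · exact (hv.1 z hz).le
  have hmap : (u ++ y :: v).map (fun z => if z = y then x else z) = u ++ x :: v := by
    rw [List.map_append, List.map_cons, if_pos rfl]
    congr 1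
    · refine (List.map_congr_left fun z hz => if_neg ?_).trans (List.map_id u)
      have := hu z hz; omega
    · congr 1
      refine (List.map_congr_left fun z hz => if_neg ?_).trans (List.map_id v)
      have := hv.1 z hz; omega
  rw [rskInsert, hmin]
  simp only [hmap]

/-- The two cases of row insertion: a new entry `x` either exceeds the whole row, or is to replace the
first entry `y` exceeding it. -/
theorem append_or_bump {R : List ℕ} {x : ℕ} (hs : R.Pairwise (· < ·)) (hx : x ∉ R) :
    (∀ z ∈ R, z < x) ∨ ∃ u y v, R = u ++ y :: v ∧ (∀ z ∈ u, z < x) ∧ x < y := by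
  induction R with
  | nil => simp
  | cons a R ih =>
    have hs' := List.pairwise_cons.1 hs
    rcases lt_or_gt_of_ne (fun h : x = a => hx (by simp [h])) with h | h
    · exact Or.inr ⟨[], a, R, by simp, by simp, h⟩
    · rcases ih hs'.2 (fun h => hx (by simp [h])) with h1 | ⟨u, y, v, rfl, h1, h2⟩
      · left; simpa [h] using h1
      · exact Or.inr ⟨a :: u, y, v, by simp, by simpa [h] using h1, h2⟩

/-- After `x` has replaced `y` in a row, the row still fits over the next row, into which `y` has been
inserted: bumped entries never move to the right. -/
theorem dom_bump {u v B : List ℕ} {x y : ℕ} (hs : (u ++ y :: v).Pairwise (· < ·))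
    (hxy : x < y) (hB : B.Pairwise (· < ·)) (hyB : y ∉ B) (hd : Dom (u ++ y :: v) B)
    {Rs : Filling} (hRs : Rs.headD [] = B) :
    Dom (u ++ x :: v) ((rskInsert y Rs).headD []) := by
  have hs' := List.pairwise_append.1 hs
  have hlen : (u ++ y :: v).length = (u ++ x :: v).length := by simp
  have key : Dom (u ++ x :: v) B := by
    refine ⟨hlen ▸ hd.1, fun i h1 h2 => ?_⟩
    have := hd.2 i h1 (by omega)
    grind
  rcases append_or_bump hB hyB with h | ⟨u', y', v', rfl, h1, h2⟩
  · have e : (rskInsert y Rs).headD [] = B ++ [y] := by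
      cases Rs with
      | nil => simp at hRs; subst hRs; simp [rskInsert]
      | cons R Rs => simp at hRs; subst hRs; rw [rskInsert_append h]; rfl
    rw [e]
    -- the end of the lower row lies weakly to the left of the column of `y`
    have hl : B.length ≤ u.length := by
      by_contra! hlt
      have h3 := hd.2 u.length hlt (by simp)
      have := h _ (List.getElem_mem hlt)
      simp at h3; omega
    refine ⟨by simp; omega, fun i h3 h4 => ?_⟩
    rcases Nat.lt_or_ge i B.length with h5 | h5
    · rw [List.getElem_append_left h5]; exact key.2 i h5 h4
    · have h6 : i = B.length := by simp at h3; omega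
      subst h6
      rcases Nat.lt_or_ge B.length u.length with h7 | h7
      · rw [List.getElem_append_left h7]
        simpa using hs'.2.2 _ (List.getElem_mem h7) y (by simp)
      · have h8 : B.length = u.length := by omega
        simp [h8, hxy]
  · have e : (rskInsert y Rs).headD [] = u' ++ y :: v' := by
      cases Rs with
      | nil => simp at hRs
      | cons R Rs => simp at hRs; subst hRs; rw [rskInsert_bump hB h1 h2]; rfl
    rw [e]
    have hl : u'.length ≤ u.length := by
      by_contra! hlt
      have h3 := hd.2 u.length (by simp; omega) (by simp)
      have := h1 _ (List.getElem_mem hlt)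
      rw [List.getElem_append_left hlt] at h3
      simp at h3; omega
    refine ⟨by simpa using key.1, fun i h3 h4 => ?_⟩
    have h5 := key.2 i (by simpa using h3) h4
    rcases lt_trichotomy i u'.length with h6 | h6 | h6
    · rw [List.getElem_append_left h6] at h5 ⊢; exact h5
    · subst h6
      rcases Nat.lt_or_ge u'.length u.length with h7 | h7
      · rw [List.getElem_append_left h7]
        simpa using hs'.2.2 _ (List.getElem_mem h7) y (by simp)
      · have h8 : u'.length = u.length := by omega
        simp [h8, hxy]
    · rw [List.getElem_append_right h6.le] at h5 ⊢
      grind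

/-- Row insertion of a new entry into a tableau gives a tableau with that entry adjoined, whose
shape has one more box. -/
theorem rskInsert_spec {T : Filling} {x : ℕ} (hT : IsTab T) (hn : T.flatten.Nodup)
    (hx : x ∉ T.flatten) :
    IsTab (rskInsert x T) ∧ (rskInsert x T).flatten.Perm (x :: T.flatten) ∧
      AddsRow (shape T) (shape (rskInsert x T)) := by
  induction T generalizing x with
  | nil =>
    exact ⟨by simp [rskInsert, IsTab, dom_nil], by simp [rskInsert], by
      simpa [rskInsert, shape] using AddsRow.new⟩
  | cons R Rs ih =>
    obtain ⟨hR, hs, hd, hRs⟩ := hT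
    rw [List.flatten_cons, List.nodup_append] at hn
    rw [List.flatten_cons, List.mem_append, not_or] at hx
    rcases append_or_bump hs hx.1 with h | ⟨u, y, v, rfl, h1, h2⟩
    · rw [rskInsert_append h]
      refine ⟨⟨by simp, ?_, ?_, hRs⟩, ?_, ?_⟩
      · rw [List.pairwise_append]; simpa [hs] using h
      · refine ⟨by have := hd.1; simp at this ⊢; omega, fun i h1 h2 => ?_⟩
        rw [List.getElem_append_left (by have := hd.1; omega)]
        exact hd.2 i h1 (by have := hd.1; omega)
      · simp
      · simpa [shape] using AddsRow.here R.length (shape Rs)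
    · rw [rskInsert_bump hs h1 h2]
      have hy : y ∉ Rs.flatten := fun hy => hn.2.2 y (by simp) y hy rfl
      obtain ⟨ih1, ih2, ih3⟩ := ih hRs hn.2.1 hy
      have hs' := List.pairwise_append.1 hs
      have hv := List.pairwise_cons.1 hs'.2.1
      refine ⟨⟨by simp, ?_, ?_, ih1⟩, ?_, ?_⟩
      · rw [List.pairwise_append, List.pairwise_cons]
        refine ⟨hs'.1, ⟨fun z hz => h2.trans (hv.1 z hz), hv.2⟩, ?_⟩
        rintro z hz w hw
        rcases List.mem_cons.1 hw with rfl | hw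
        · exact h1 z hz
        · exact hs'.2.2 z hz w (by simp [hw])
      · refine dom_bump hs h2 ?_ ?_ hd rfl
        · cases Rs with
          | nil => simp
          | cons B Bs => exact hRs.2.1
        · cases Rs with
          | nil => simp
          | cons B Bs => exact fun h => hy (by simp at h; simp [h])
      · rw [List.flatten_cons, List.flatten_cons]
        refine (List.Perm.append_left _ ih2).trans ?_
        simp only [List.append_assoc, List.cons_append]
        refine List.perm_middle.trans (List.Perm.cons _ (List.Perm.append_left _ ?_))
        exact List.perm_middle
      · simpa [shape] using AddsRow.lower _ ih3

/-! ### Undoing row insertion -/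

/-- A list of row lengths of a Young diagram: weakly decreasing and positive. -/
def IsPart (μ : List ℕ) : Prop := μ.Pairwise (· ≥ ·) ∧ ∀ a ∈ μ, 0 < a

theorem IsPart.tail {a : ℕ} {μ : List ℕ} (h : IsPart (a :: μ)) : IsPart μ :=
  ⟨(List.pairwise_cons.1 h.1).2, fun b hb => h.2 b (by simp [hb])⟩

theorem IsPart.headD_le {a : ℕ} {Rs : Filling} (h : IsPart (a :: shape Rs)) :
    (Rs.headD []).length ≤ a := by
  cases Rs with
  | nil => simp
  | cons B Bs => exact (List.pairwise_cons.1 h.1).1 _ (by simp [shape])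

theorem IsTab.pairwise_headD {T : Filling} (h : IsTab T) : (T.headD []).Pairwise (· < ·) := by
  cases T with
  | nil => simp
  | cons B Bs => exact h.2.1

theorem mem_flatten_of_mem_headD {T : Filling} {z : ℕ} (h : z ∈ T.headD []) : z ∈ T.flatten := by
  cases T with
  | nil => simp at h
  | cons B Bs => simp at h; simp [h]

theorem exists_mem_headD_le {T : Filling} (h : IsTab T) {y : ℕ} (hy : y ∈ T.flatten) :
    ∃ z ∈ T.headD [], z ≤ y := by
  induction T with
  | nil => simp at hy
  | cons R Rs ih =>
    rw [List.flatten_cons, List.mem_append] at hy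
    rcases hy with hy | hy
    · exact ⟨y, hy, le_rfl⟩
    · obtain ⟨z, hz, hzy⟩ := ih h.2.2.2 hy
      obtain ⟨i, hi, rfl⟩ := List.getElem_of_mem hz
      have h1 := h.2.2.1
      exact ⟨R[i]'(hi.trans_le h1.1), List.getElem_mem _, ((h1.2 i hi _).trans_le hzy).le⟩

/-- To undo a bump by which `y` left the row, `y` takes the place of the last entry smaller than
it. -/
theorem exists_unbump {R : List ℕ} {y : ℕ} (hs : R.Pairwise (· < ·)) (hy : y ∉ R)
    (hz : ∃ z ∈ R, z < y) :
    ∃ u x v, R = u ++ x :: v ∧ x < y ∧ ∀ z ∈ v, y < z := by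
  obtain ⟨z, hz, hzy⟩ := hz
  rcases append_or_bump hs hy with h | ⟨u, w, v, rfl, h1, h2⟩
  · have hR : R ≠ [] := List.ne_nil_of_mem hz
    exact ⟨R.dropLast, R.getLast hR, [], (List.dropLast_append_getLast hR).symm,
      h _ (List.getLast_mem hR), by simp⟩
  · have hs' := List.pairwise_append.1 hs
    have hv := List.pairwise_cons.1 hs'.2.1
    have hu : u ≠ [] := by
      rintro rfl
      rcases List.mem_cons.1 hz with rfl | hz
      · omega
      · have := hv.1 z hz; omega
    refine ⟨u.dropLast, u.getLast hu, w :: v, ?_, h1 _ (List.getLast_mem hu), ?_⟩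
    · conv_lhs => rw [← List.dropLast_append_getLast hu]
      simp
    · intro z hz
      rcases List.mem_cons.1 hz with rfl | hz
      · exact h2
      · exact h2.trans (hv.1 z hz)

/-- After `y` has returned to its row, this row still fits over the row from which `y` has been
removed. -/
theorem dom_unbump {u v B : List ℕ} {x y : ℕ} (hv : ∀ z ∈ v, y < z)
    (hB : B.Pairwise (· < ·)) (hyB : y ∉ B) {Rs : Filling} (hRs : Rs.headD [] = B)
    (hd : Dom (u ++ x :: v) ((rskInsert y Rs).headD [])) :
    Dom (u ++ y :: v) B := by
  rcases append_or_bump hB hyB with h | ⟨u', y', v', rfl, h1, h2⟩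
  · have e : (rskInsert y Rs).headD [] = B ++ [y] := by
      cases Rs with
      | nil => simp at hRs; subst hRs; simp [rskInsert]
      | cons R Rs => simp at hRs; subst hRs; rw [rskInsert_append h]; rfl
    rw [e] at hd
    have h3 := hd.1
    have hl : B.length ≤ u.length := by
      by_contra! hlt
      have h4 := hd.2 B.length (by simp) (by simp at h3 ⊢; omega)
      rw [List.getElem_append_right hlt.le] at h4
      have := hv ((u ++ x :: v)[B.length]'(by simp at h3 ⊢; omega)) (by grind)
      grind
    refine ⟨by simp; omega, fun i h5 h6 => ?_⟩
    have h7 := hd.2 i (by simp; omega) (by simp; omega)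
    rw [List.getElem_append_left (by omega)] at h7 ⊢
    rwa [List.getElem_append_left (by omega)] at h7
  · have e : (rskInsert y Rs).headD [] = u' ++ y :: v' := by
      cases Rs with
      | nil => simp at hRs
      | cons R Rs => simp at hRs; subst hRs; rw [rskInsert_bump hB h1 h2]; rfl
    rw [e] at hd
    have h3 := hd.1
    have hB' := List.pairwise_append.1 hB
    have hv' := List.pairwise_cons.1 hB'.2.1
    have hl : u'.length ≤ u.length := by
      by_contra! hlt
      have h4 := hd.2 u'.length (by simp) (by simp at h3 ⊢; omega)
      have := hv ((u ++ x :: v)[u'.length]'(by simp at h3 ⊢; omega)) (by grind)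
      grind
    refine ⟨by simp at h3 ⊢; omega, fun i h5 h6 => ?_⟩
    have h7 := hd.2 i (by simp at h5 ⊢; omega) (by simp at h6 ⊢; omega)
    rcases lt_trichotomy i u.length with h8 | h8 | h8
    · grind
    · subst h8
      have h9 : (u' ++ y' :: v')[u.length] = y' ∨ (u' ++ y' :: v')[u.length] ∈ v' := by grind
      have h10 : (u ++ y :: v)[u.length] = y := by simp
      rw [h10]
      rcases h9 with h9 | h9
      · omega
      · exact h2.trans (hv'.1 _ h9)
    · grind

/-- Row insertion can be undone: for every corner of a tableau there is a smaller tableau and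
an entry whose insertion adds just this corner. -/
theorem exists_rskInsert_eq {T : Filling} {μ : List ℕ} (hT : IsTab T) (hn : T.flatten.Nodup)
    (hμ : IsPart μ) (h : AddsRow μ (shape T)) :
    ∃ x T', IsTab T' ∧ shape T' = μ ∧ rskInsert x T' = T ∧ T.flatten.Perm (x :: T'.flatten) := by
  induction T generalizing μ with
  | nil => simp [shape] at h; cases h
  | cons R Rs ih =>
    obtain ⟨hR, hs, hd, hRs⟩ := hT
    generalize hν : shape (R :: Rs) = ν at h
    cases h with
    | new =>
      simp [shape, List.length_eq_one_iff] at hν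
      obtain ⟨⟨x, rfl⟩, rfl⟩ := hν
      exact ⟨x, [], trivial, rfl, by simp [rskInsert], by simp⟩
    | here a μ =>
      simp only [shape, List.map_cons, List.cons.injEq] at hν
      obtain ⟨h1, rfl⟩ := hν
      have ha := hμ.2 a (by simp)
      obtain ⟨R0, x, rfl⟩ : ∃ R0 x, R = R0 ++ [x] :=
        ⟨R.dropLast, R.getLast hR, (List.dropLast_append_getLast hR).symm⟩
      simp at h1; subst h1
      have hs' := List.pairwise_append.1 hs
      refine ⟨x, R0 :: Rs, ⟨List.ne_nil_of_length_pos ha, hs'.1, ?_, hRs⟩, rfl,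
        rskInsert_append (fun z hz => hs'.2.2 z hz x (by simp)) Rs, ?_⟩
      · have hl : (Rs.headD []).length ≤ R0.length := IsPart.headD_le hμ
        refine ⟨hl, fun i h1 h2 => ?_⟩
        have := hd.2 i h1 (by simp; omega)
        rwa [List.getElem_append_left h2] at this
      · simp
    | lower a h =>
      rename_i μ ν
      simp only [shape, List.map_cons, List.cons.injEq] at hν
      obtain ⟨rfl, rfl⟩ := hν
      rw [List.flatten_cons, List.nodup_append] at hn
      obtain ⟨y, Rs', ih1, rfl, rfl, ih4⟩ := ih hRs hn.2.1 hμ.tail h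
      have hn' := ih4.nodup_iff.1 hn.2.1
      have hyR : y ∉ R := fun hy => hn.2.2 y hy y (ih4.mem_iff.2 (by simp)) rfl
      have hyB : y ∉ Rs'.headD [] := fun hy =>
        (List.nodup_cons.1 hn').1 (mem_flatten_of_mem_headD hy)
      have hy : ∃ z ∈ R, z < y := by
        have hmem : y ∈ (R :: rskInsert y Rs').flatten := by
          rw [List.flatten_cons]
          exact List.mem_append_right _ (ih4.mem_iff.2 (by simp))
        obtain ⟨z, hz, hzy⟩ :=
          exists_mem_headD_le (T := R :: rskInsert y Rs') ⟨hR, hs, hd, hRs⟩ hmem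
        exact ⟨z, hz, lt_of_le_of_ne hzy (fun e => hyR (e ▸ hz))⟩
      obtain ⟨u, x, v, rfl, hxy, hv⟩ := exists_unbump hs hyR hy
      have hs' := List.pairwise_append.1 hs
      have hv' := List.pairwise_cons.1 hs'.2.1
      have hsy : (u ++ y :: v).Pairwise (· < ·) := by
        rw [List.pairwise_append, List.pairwise_cons]
        refine ⟨hs'.1, ⟨hv, hv'.2⟩, fun z hz w hw => ?_⟩
        have := hs'.2.2 z hz x (by simp)
        rcases List.mem_cons.1 hw with rfl | hw
        · omega
        · have := hv w hw; omega
      refine ⟨x, (u ++ y :: v) :: Rs', ⟨by simp, hsy, ?_, ih1⟩, by simp [shape],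
        rskInsert_bump hsy (fun z hz => hs'.2.2 z hz x (by simp)) hxy Rs', ?_⟩
      · exact dom_unbump hv ih1.pairwise_headD hyB rfl hd
      · rw [List.flatten_cons, List.flatten_cons]
        refine (List.Perm.append_left _ ih4).trans ?_
        simp only [List.append_assoc, List.cons_append]
        refine List.perm_middle.trans (List.Perm.cons _ (List.Perm.append_left _ ?_))
        exact List.perm_middle

/-! ### Jeu de taquin -/

theorem jdtSlide_right {l r : List ℕ} {a : ℕ} {Bs : Filling}
    (h : ∀ b, (Bs.headD [])[l.length]? = some b → a < b) :
    jdtSlide l (a :: r) Bs = jdtSlide (l ++ [a]) r Bs := by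
  cases Bs with
  | nil => rw [jdtSlide]
  | cons B Bs =>
    rw [jdtSlide]
    cases hb : B[l.length]? with
    | none => rfl
    | some b => simp only [if_pos (h b hb)]

theorem jdtSlide_down {l r l' r' : List ℕ} {b : ℕ} {Bs : Filling} (hl : l'.length = l.length)
    (h : ∀ z ∈ r, b < z) :
    jdtSlide l r ((l' ++ b :: r') :: Bs) = (l ++ b :: r) :: jdtSlide l' r' Bs := by
  have hb : (l' ++ b :: r')[l.length]? = some b := by simp [← hl]
  have ht : (l' ++ b :: r').take l.length = l' := by simp [← hl]
  have hd : (l' ++ b :: r').drop (l.length + 1) = r' := by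
    rw [← hl, ← List.drop_drop]; simp
  cases r with
  | nil => rw [jdtSlide]; simp only [hb, ht, hd]
  | cons a r =>
    have := h a (by simp)
    rw [jdtSlide]; simp only [hb, ht, hd, if_neg (not_lt.2 this.le)]

theorem jdtSlide_stop {l : List ℕ} {Bs : Filling} (hl : l ≠ [])
    (h : (Bs.headD []).length ≤ l.length) : jdtSlide l [] Bs = l :: Bs := by
  cases Bs with
  | nil => rw [jdtSlide, if_neg hl]
  | cons B Bs =>
    have hb : B[l.length]? = none := by simpa using h
    rw [jdtSlide]; simp only [hb, if_neg hl]

theorem getElem_append_cons_right (l r : List ℕ) (x i : ℕ) (hi : i < r.length)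
    (h : l.length + 1 + i < (l ++ x :: r).length) :
    (l ++ x :: r)[l.length + 1 + i] = r[i] := by
  rw [List.getElem_append_right (by omega), ← List.getElem_cons_succ x r i (by simpa using hi)]
  congr 1; omega

/-- The rows `l ++ [·] ++ r` and `Bs`, with a hole between `l` and `r`, are a tableau up to
the hole. -/
structure IsHole (l r : List ℕ) (Bs : Filling) : Prop where
  sorted : (l ++ r).Pairwise (· < ·)
  len : (Bs.headD []).length ≤ l.length + 1 + r.length
  left : ∀ i (h : i < (Bs.headD []).length) (hl : i < l.length), l[i] < (Bs.headD [])[i]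
  right : ∀ i (h : l.length + 1 + i < (Bs.headD []).length) (hr : i < r.length),
    r[i] < (Bs.headD [])[l.length + 1 + i]
  tab : IsTab Bs

/-- The row `U` may stand above the row `l ++ [·] ++ r` with a hole, below which is the row `B`:
its entries are smaller than the entries below them, and the one above the hole is smaller than
the entry below the hole. -/
structure AboveHole (U l r B : List ℕ) : Prop where
  len : l.length + 1 + r.length ≤ U.length
  left : ∀ i (h : i < U.length) (hl : i < l.length), U[i] < l[i]
  right : ∀ i (h : l.length + 1 + i < U.length) (hr : i < r.length), U[l.length + 1 + i] < r[i]
  hole : ∀ (h : l.length < U.length) (hB : l.length < B.length), U[l.length] < B[l.length]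

theorem AboveHole.of_dom {U l r B : List ℕ} {b : ℕ} (h : Dom U (l ++ b :: r))
    (hb : ∀ (hB : l.length < B.length), b ≤ B[l.length]) : AboveHole U l r B := by
  have h0 := h.1
  simp at h0
  refine ⟨by omega, fun i hi hl => ?_, fun i hi hr => ?_, fun hi hB => ?_⟩
  · have := h.2 i (by simp; omega) hi
    rwa [List.getElem_append_left hl] at this
  · have := h.2 (l.length + 1 + i) (by simp; omega) hi
    rwa [getElem_append_cons_right _ _ _ _ hr] at this
  · have := h.2 l.length (by simp) hi
    have := hb hB
    simp at *; omega

theorem IsHole.moveRight {l r : List ℕ} {a : ℕ} {Bs : Filling} (h : IsHole l (a :: r) Bs)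
    (ha : ∀ (hB : l.length < (Bs.headD []).length), a < (Bs.headD [])[l.length]) :
    IsHole (l ++ [a]) r Bs := by
  refine ⟨by simpa using h.sorted, ?_, fun i hi hl => ?_, fun i hi hr => ?_, h.tab⟩
  · have := h.len; simp at this ⊢; omega
  · rcases Nat.lt_or_ge i l.length with h1 | h1
    · rw [List.getElem_append_left h1]; exact h.left i hi h1
    · have h2 : i = l.length := by simp at hl; omega
      subst h2; simpa using ha hi
  · have hi' := hi
    simp only [List.length_append, List.length_singleton] at hi'
    have := h.right (i + 1) (by omega) (by simpa using hr)
    rw [List.getElem_cons_succ] at this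
    convert this using 2
    simp only [List.length_append, List.length_singleton]; omega

theorem IsHole.of_isTab {l r : List ℕ} {x : ℕ} {Bs : Filling}
    (h : IsTab ((l ++ x :: r) :: Bs)) : IsHole l r Bs := by
  obtain ⟨h1, h2, h3, h4⟩ := h
  have h0 := h3.1
  simp only [List.length_append, List.length_cons] at h0
  refine ⟨h2.sublist (by simp), by omega, fun i hi hl => ?_, fun i hi hr => ?_, h4⟩
  · have := h3.2 i hi (by simp; omega)
    rwa [List.getElem_append_left hl] at this
  · have := h3.2 (l.length + 1 + i) hi (by simp; omega)
    rwa [getElem_append_cons_right _ _ _ _ hr] at this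

/-- An entry which fits in between its neighbours fills the hole. -/
theorem IsHole.isTab {l r : List ℕ} {x : ℕ} {Bs : Filling} (h : IsHole l r Bs)
    (hl : ∀ z ∈ l, z < x) (hr : ∀ z ∈ r, x < z)
    (hB : ∀ (hB : l.length < (Bs.headD []).length), x < (Bs.headD [])[l.length]) :
    IsTab ((l ++ x :: r) :: Bs) := by
  have hs := List.pairwise_append.1 h.sorted
  have h0 := h.len
  refine ⟨by simp, ?_, ⟨?_, fun i h1 h2 => ?_⟩, h.tab⟩
  · rw [List.pairwise_append, List.pairwise_cons]
    refine ⟨hs.1, ⟨hr, hs.2.1⟩, fun z hz w hw => ?_⟩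
    rcases List.mem_cons.1 hw with rfl | hw
    · exact hl z hz
    · exact hs.2.2 z hz w hw
  · simp only [List.length_append, List.length_cons]; omega
  · rcases lt_trichotomy i l.length with h3 | h3 | h3
    · rw [List.getElem_append_left h3]; exact h.left i h1 h3
    · subst h3; simpa using hB h1
    · obtain ⟨j, rfl⟩ : ∃ j, i = l.length + 1 + j := ⟨i - l.length - 1, by omega⟩
      have := h.right j h1 (by simp at h2; omega)
      rwa [getElem_append_cons_right]

theorem AboveHole.moveRight {U l r B : List ℕ} {a : ℕ} (h : AboveHole U l (a :: r) B)
    (hU : U.Pairwise (· < ·)) (hB : B.Pairwise (· < ·))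
    (ha : ∀ (hB : l.length < B.length), a < B[l.length]) : AboveHole U (l ++ [a]) r B := by
  have h0 := h.len
  simp only [List.length_cons] at h0
  have h1 := h.right 0 (by omega) (by simp)
  simp only [Nat.add_zero, List.getElem_cons_zero] at h1
  have h2 := List.pairwise_iff_getElem.1 hU l.length (l.length + 1) (by omega) (by omega)
    (by omega)
  refine ⟨by simp; omega, fun i hi hl => ?_, fun i hi hr => ?_, fun hi hl => ?_⟩
  · rcases Nat.lt_or_ge i l.length with h3 | h3
    · rw [List.getElem_append_left h3]; exact h.left i hi h3
    · have h4 : i = l.length := by simp at hl; omega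
      subst h4; simp; omega
  · have h3 := h.right (i + 1) (by simp at hi; omega) (by simpa using hr)
    rw [List.getElem_cons_succ] at h3
    convert h3 using 2
    simp only [List.length_append, List.length_singleton]; omega
  · simp only [List.length_append, List.length_singleton] at hl
    have h3 := ha (by omega)
    have h4 := List.pairwise_iff_getElem.1 hB l.length (l.length + 1) (by omega) (by omega)
      (by omega)
    simp only [List.length_append, List.length_singleton]
    omega

/-- Sliding a hole out of a tableau leaves a tableau with the same entries, whose shape has one
box less. The last part allows to put rows above. -/
theorem jdtSlide_spec {l r : List ℕ} {Bs : Filling} (h : IsHole l r Bs)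
    (hn : (l ++ r ++ Bs.flatten).Nodup) :
    IsTab (jdtSlide l r Bs) ∧ (jdtSlide l r Bs).flatten.Perm (l ++ r ++ Bs.flatten) ∧
      AddsRow (shape (jdtSlide l r Bs)) ((l.length + 1 + r.length) :: shape Bs) ∧
      ∀ U : List ℕ, U.Pairwise (· < ·) → AboveHole U l r (Bs.headD []) →
        Dom U ((jdtSlide l r Bs).headD []) := by
  induction Bs generalizing l r with
  | nil =>
    induction r generalizing l with
    | nil =>
      by_cases hl : l = []
      · subst hl
        rw [jdtSlide, if_pos rfl]
        exact ⟨trivial, by simp, AddsRow.new, fun U _ _ => dom_nil U⟩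
      · rw [jdtSlide_stop hl (by simp)]
        refine ⟨⟨hl, by simpa using h.sorted, dom_nil _, trivial⟩, by simp, AddsRow.here _ _,
          fun U hU hA => ⟨?_, fun i h1 h2 => hA.left i h2 h1⟩⟩
        have := hA.len
        simp at this ⊢; omega
    | cons a r ihr =>
      rw [jdtSlide_right (by simp)]
      obtain ⟨h1, h2, h3, h4⟩ := ihr (h.moveRight (by simp)) (by simpa using hn)
      refine ⟨h1, by simpa using h2, ?_, fun U hU hA => h4 U hU ?_⟩
      · convert h3 using 2; simp; omega
      · exact hA.moveRight hU (by simp) (by simp)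
  | cons B Bs ih =>
    have hB := h.tab
    -- the step in which the lower neighbour `b` of the hole moves up
    have down : ∀ l r l' b r', IsHole l r ((l' ++ b :: r') :: Bs) →
        (l ++ r ++ ((l' ++ b :: r') :: Bs).flatten).Nodup → l'.length = l.length →
        (∀ z ∈ r, b < z) →
        IsTab (jdtSlide l r ((l' ++ b :: r') :: Bs)) ∧
        (jdtSlide l r ((l' ++ b :: r') :: Bs)).flatten.Perm
          (l ++ r ++ ((l' ++ b :: r') :: Bs).flatten) ∧
        AddsRow (shape (jdtSlide l r ((l' ++ b :: r') :: Bs)))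
          ((l.length + 1 + r.length) :: shape ((l' ++ b :: r') :: Bs)) ∧
        ∀ U : List ℕ, U.Pairwise (· < ·) → AboveHole U l r (l' ++ b :: r') →
          Dom U ((jdtSlide l r ((l' ++ b :: r') :: Bs)).headD []) := by
      intro l r l' b r' h hn hll hr
      rw [jdtSlide_down hll hr]
      have hB := h.tab
      have hBs := List.pairwise_append.1 hB.2.1
      have hs := List.pairwise_append.1 h.sorted
      have hlb : ∀ z ∈ l, z < b := by
        intro z hz
        obtain ⟨i, hi, rfl⟩ := List.getElem_of_mem hz
        have h1 := h.left i (by simp; omega) hi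
        simp only [List.headD_cons] at h1
        rw [List.getElem_append_left (by omega)] at h1
        exact h1.trans (hBs.2.2 _ (List.getElem_mem _) b (by simp))
      have hn1 : (l' ++ r' ++ Bs.flatten).Nodup := by
        refine hn.sublist ?_
        rw [List.flatten_cons]
        refine List.Sublist.trans ?_ (List.sublist_append_right _ _)
        exact List.Sublist.append_right (by simp) _
      obtain ⟨h1, h2, h3, h4⟩ := ih (IsHole.of_isTab hB) hn1
      have hlen := h.len
      simp only [List.headD_cons, List.length_append, List.length_cons] at hlen
      have hbB : ∀ (hb : l'.length < (Bs.headD []).length), b < (Bs.headD [])[l'.length] := by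
        intro hb
        simpa using hB.2.2.1.2 l'.length hb (by simp)
      refine ⟨⟨by simp, ?_, ?_, h1⟩, ?_, ?_, fun U hU hA => ?_⟩
      · rw [List.pairwise_append, List.pairwise_cons]
        refine ⟨hs.1, ⟨hr, hs.2.1⟩, fun z hz w hw => ?_⟩
        rcases List.mem_cons.1 hw with rfl | hw
        · exact hlb z hz
        · exact hs.2.2 z hz w hw
      · refine h4 _ ?_ ⟨by simp; omega, fun i hi hl => ?_, fun i hi hr => ?_, fun hi hl => ?_⟩
        · rw [List.pairwise_append, List.pairwise_cons]
          refine ⟨hs.1, ⟨hr, hs.2.1⟩, fun z hz w hw => ?_⟩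
          rcases List.mem_cons.1 hw with rfl | hw
          · exact hlb z hz
          · exact hs.2.2 z hz w hw
        · have h5 := h.left i (by simp; omega) (by omega)
          simp only [List.headD_cons] at h5
          rw [List.getElem_append_left hl] at h5
          rwa [List.getElem_append_left (by omega)]
        · have hi' := hi
          simp only [List.length_append, List.length_cons] at hi'
          have h5 := h.right i (by simp; omega) (by omega)
          simp only [List.headD_cons, ← hll] at h5
          rw [getElem_append_cons_right _ _ _ _ hr] at h5
          simp only [hll]
          rwa [getElem_append_cons_right]
        · simpa [hll] using hbB hl
      · rw [List.flatten_cons, List.flatten_cons]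
        refine (List.Perm.append_left _ h2).trans ?_
        simp only [List.append_assoc, List.cons_append]
        refine List.Perm.append_left _ ?_
        refine List.perm_middle.symm.trans (List.Perm.append_left _ ?_)
        exact List.perm_middle.symm
      · have e : (l' ++ b :: r').length = l'.length + 1 + r'.length := by simp; omega
        have e2 : (l ++ b :: r).length = l.length + 1 + r.length := by simp; omega
        simp only [shape, List.map_cons, e, e2]
        exact AddsRow.lower _ h3
      · have hAl := hA.len
        refine ⟨by simp; omega, fun i h5 h6 => ?_⟩
        simp only [List.headD_cons, List.length_append, List.length_cons] at h5 ⊢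
        rcases lt_trichotomy i l.length with h7 | h7 | h7
        · rw [List.getElem_append_left h7]; exact hA.left i h6 h7
        · subst h7
          have h8 := hA.hole h6 (by simp; omega)
          simpa [← hll] using h8
        · obtain ⟨j, rfl⟩ : ∃ j, i = l.length + 1 + j := ⟨i - l.length - 1, by omega⟩
          rw [getElem_append_cons_right _ _ _ _ (by omega)]
          exact hA.right j h6 (by omega)
    have split : ∀ (l : List ℕ) (hl : l.length < B.length),
        ∃ l' r', B = l' ++ B[l.length] :: r' ∧ l'.length = l.length := fun l hl =>
      ⟨B.take l.length, B.drop (l.length + 1), by simp, by simp; omega⟩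
    induction r generalizing l with
    | nil =>
      rcases Nat.lt_or_ge l.length B.length with hl | hl
      · obtain ⟨l', r', e, e'⟩ := split l hl
        generalize B[l.length] = b at e
        subst e
        exact down l [] l' b r' h hn e' (by simp)
      · have hl0 : l ≠ [] := by
          rintro rfl
          exact hB.1 (by simpa using hl)
        rw [jdtSlide_stop (Bs := B :: Bs) hl0 hl]
        refine ⟨⟨hl0, by simpa using h.sorted, ⟨hl, fun i h1 h2 => h.left i h1 h2⟩, hB⟩, by simp,
          AddsRow.here _ _, fun U hU hA => ⟨?_, fun i h1 h2 => hA.left i h2 h1⟩⟩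
        have := hA.len
        simp at this ⊢; omega
    | cons a r ihr =>
      by_cases hc : ∀ hl : l.length < B.length, a < B[l.length]
      · rw [jdtSlide_right (by
          intro b hb
          obtain ⟨hl, rfl⟩ := List.getElem?_eq_some_iff.1 hb
          exact hc hl)]
        obtain ⟨h1, h2, h3, h4⟩ := ihr (h.moveRight hc) (by simpa using hn)
        refine ⟨h1, by simpa using h2, ?_, fun U hU hA => h4 U hU ?_⟩
        · convert h3 using 2; simp; omega
        · exact hA.moveRight hU hB.2.1 hc
      · push Not at hc
        obtain ⟨hl, hc⟩ := hc
        obtain ⟨l', r', e, e'⟩ := split l hl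
        generalize B[l.length] = b at e hc
        subst e
        have hba : b ≠ a := by
          rintro rfl
          simp [List.nodup_append] at hn
        have hs := List.pairwise_cons.1 (List.pairwise_append.1 h.sorted).2.1
        refine down l (a :: r) l' b r' h hn e' fun z hz => ?_
        rcases List.mem_cons.1 hz with rfl | hz
        · omega
        · have := hs.1 z hz; omega

theorem jdtDelete_mem {l r : List ℕ} {x : ℕ} (hx : x ∉ l) (Bs : Filling) :
    jdtDelete x ((l ++ x :: r) :: Bs) = jdtSlide l r Bs := by
  have h1 : (l ++ x :: r).idxOf x = l.length := by
    rw [List.idxOf_append_of_notMem hx]; simp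
  rw [jdtDelete, if_pos (by simp), h1, ← List.drop_drop]
  simp

/-- Removing an entry of a tableau by jeu de taquin gives a tableau with the other entries, whose
shape has one box less. -/
theorem jdtDelete_spec {T : Filling} {x : ℕ} (hT : IsTab T) (hn : T.flatten.Nodup)
    (hx : x ∈ T.flatten) :
    IsTab (jdtDelete x T) ∧ T.flatten.Perm (x :: (jdtDelete x T).flatten) ∧
      AddsRow (shape (jdtDelete x T)) (shape T) ∧
      ∀ U : List ℕ, U.Pairwise (· < ·) → Dom U (T.headD []) →
        Dom U ((jdtDelete x T).headD []) := by
  induction T with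
  | nil => simp at hx
  | cons R Rs ih =>
    have hn0 := hn
    rw [List.flatten_cons, List.nodup_append] at hn
    by_cases hxR : x ∈ R
    · obtain ⟨l, r, rfl⟩ := List.append_of_mem hxR
      have hs := List.pairwise_append.1 hT.2.1
      have hxl : x ∉ l := fun h => lt_irrefl x (hs.2.2 x h x (by simp))
      rw [jdtDelete_mem hxl]
      have hp : ((l ++ x :: r) :: Rs).flatten.Perm (x :: (l ++ r ++ Rs.flatten)) := by
        rw [List.flatten_cons, List.append_assoc, List.append_assoc, List.cons_append]
        exact List.perm_middle
      obtain ⟨h1, h2, h3, h4⟩ := jdtSlide_spec (IsHole.of_isTab hT)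
        (List.nodup_cons.1 (hp.nodup_iff.1 hn0)).2
      refine ⟨h1, hp.trans (h2.symm.cons x), ?_, fun U hU hd => h4 U hU ?_⟩
      · convert h3 using 1; simp [shape]; omega
      · refine AboveHole.of_dom (b := x) hd fun hB => ?_
        have := hT.2.2.1.2 l.length hB (by simp)
        simp at this; simpa using this.le
    · have hx' : x ∈ Rs.flatten := by
        rw [List.flatten_cons, List.mem_append] at hx
        exact hx.resolve_left hxR
      obtain ⟨h1, h2, h3, h4⟩ := ih hT.2.2.2 hn.2.1 hx'
      rw [jdtDelete, if_neg hxR]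
      refine ⟨⟨hT.1, hT.2.1, h4 R hT.2.1 hT.2.2.1, h1⟩, ?_, AddsRow.lower _ h3, fun U _ hd => hd⟩
      rw [List.flatten_cons, List.flatten_cons]
      exact (List.Perm.append_left _ h2).trans List.perm_middle

/-! ### Undoing jeu de taquin -/

/-- The hole moves horizontally past the entries `s` if each of them is smaller than the entry below
the hole at the moment when it is the right neighbour of the hole. -/
theorem jdtSlide_append {l s r : List ℕ} {Bs : Filling}
    (h : ∀ i (hi : i < s.length) (hB : l.length + i < (Bs.headD []).length),
      s[i] < (Bs.headD [])[l.length + i]) :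
    jdtSlide l (s ++ r) Bs = jdtSlide (l ++ s) r Bs := by
  induction s generalizing l with
  | nil => simp
  | cons a s ih =>
    rw [List.cons_append, jdtSlide_right, ih]
    · simp
    · intro i hi hB
      have h1 := h (i + 1) (by simpa using hi)
        (by simp only [List.length_append, List.length_singleton] at hB; omega)
      rw [List.getElem_cons_succ] at h1
      convert h1 using 2
      simp only [List.length_append, List.length_singleton]; omega
    · intro b hb
      obtain ⟨hl, rfl⟩ := List.getElem?_eq_some_iff.1 hb
      exact h 0 (by simp) hl

/-- Reverse slides within a row are always possible: the hole may be moved to the left. -/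
theorem IsHole.moveLeft {l s r : List ℕ} {Bs : Filling} (h : IsHole (l ++ s) r Bs) :
    IsHole l (s ++ r) Bs := by
  have h0 := h.len
  simp only [List.length_append] at h0
  refine ⟨by simpa using h.sorted, by simp only [List.length_append]; omega,
    fun i hi hl => ?_, fun i hi hr => ?_, h.tab⟩
  · have := h.left i hi (by simp; omega)
    rwa [List.getElem_append_left hl] at this
  · rcases Nat.lt_or_ge i s.length with h1 | h1
    · have h2 := h.left (l.length + i) (by omega) (by simp; omega)
      rw [List.getElem_append_right (by omega)] at h2
      have h3 := List.pairwise_iff_getElem.1 h.tab.pairwise_headD (l.length + i)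
        (l.length + 1 + i) (by omega) hi (by omega)
      rw [List.getElem_append_left h1]
      simp only [Nat.add_sub_cancel_left] at h2
      omega
    · simp only [List.length_append] at hr
      have h2 := h.right (i - s.length) (by simp only [List.length_append]; omega) (by omega)
      rw [List.getElem_append_right h1]
      convert h2 using 2
      simp only [List.length_append]; omega

theorem IsHole.jdtSlide_moveLeft {l s r : List ℕ} {Bs : Filling} (h : IsHole (l ++ s) r Bs) :
    jdtSlide l (s ++ r) Bs = jdtSlide (l ++ s) r Bs := by
  refine jdtSlide_append fun i hi hB => ?_
  have h2 := h.left (l.length + i) (by omega) (by simp; omega)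
  rw [List.getElem_append_right (by omega)] at h2
  simpa using h2

/-- The state of reverse jeu de taquin in which `x`, on its way from a new corner of `T` up and to
the left, has reached the first row, so that it is to be placed somewhere in this row weakly to the
left of the hole between `l` and `r`. Here `ν` is the shape of `T` with the new corner. -/
structure RevHole (T : Filling) (ν : List ℕ) (x : ℕ) (l r : List ℕ) (Bs : Filling) : Prop where
  hole : IsHole l r Bs
  slide : jdtSlide l r Bs = T
  shape_eq : (l.length + 1 + r.length) :: shape Bs = ν
  perm : (l ++ r ++ Bs.flatten).Perm T.flatten
  right : ∀ z ∈ r, x < z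
  below : ∀ (hB : l.length < (Bs.headD []).length), x < (Bs.headD [])[l.length]
  head : (T.headD [] = l ∧ r = [] ∧ (Bs.headD []).length ≤ l.length) ∨
    ∃ b, T.headD [] = l ++ b :: r ∧ (Bs.headD [])[l.length]? = some b

theorem exists_split {l : List ℕ} {x : ℕ} (hl : l.Pairwise (· < ·)) (hx : x ∉ l) :
    ∃ a c, l = a ++ c ∧ (∀ z ∈ a, z < x) ∧ ∀ z ∈ c, x < z := by
  rcases append_or_bump hl hx with h | ⟨u, y, v, rfl, h1, h2⟩
  · exact ⟨l, [], by simp, h, by simp⟩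
  · refine ⟨u, y :: v, rfl, h1, fun z hz => ?_⟩
    rcases List.mem_cons.1 hz with rfl | hz
    · exact h2
    · exact h2.trans ((List.pairwise_cons.1 (List.pairwise_append.1 hl).2.1).1 z hz)

/-- Placing `x` in its row completes reverse jeu de taquin. -/
theorem RevHole.place {T : Filling} {ν : List ℕ} {x : ℕ} {a c r : List ℕ} {Bs : Filling}
    (h : RevHole T ν x (a ++ c) r Bs) (ha : ∀ z ∈ a, z < x) (hc : ∀ z ∈ c, x < z) :
    IsTab ((a ++ x :: (c ++ r)) :: Bs) ∧ shape ((a ++ x :: (c ++ r)) :: Bs) = ν ∧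
      jdtDelete x ((a ++ x :: (c ++ r)) :: Bs) = T ∧
      ((a ++ x :: (c ++ r)) :: Bs).flatten.Perm (x :: T.flatten) := by
  refine ⟨h.hole.moveLeft.isTab ha (fun z hz => ?_) fun hB => ?_, ?_, ?_, ?_⟩
  · rcases List.mem_append.1 hz with hz | hz
    · exact hc z hz
    · exact h.right z hz
  · cases c with
    | nil => simpa using h.below (by simpa using hB)
    | cons y c =>
      have := h.hole.left a.length hB (by simp)
      simp only [List.getElem_append_right le_rfl, Nat.sub_self, List.getElem_cons_zero] at this
      exact (hc y (by simp)).trans this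
  · rw [← h.shape_eq]; simp [shape]; omega
  · rw [jdtDelete_mem (fun hx => lt_irrefl x (ha x hx)), h.hole.jdtSlide_moveLeft, h.slide]
  · rw [List.flatten_cons, List.append_assoc, List.cons_append]
    refine List.perm_middle.trans (List.Perm.cons _ ?_)
    simpa using h.perm

theorem forall_not_or_exists_greatest (Q : ℕ → Prop) (n : ℕ) :
    (∀ i ≤ n, ¬ Q i) ∨ ∃ q ≤ n, Q q ∧ ∀ i, q < i → i ≤ n → ¬ Q i := by
  classical
  by_cases h : ∃ i ≤ n, Q i
  · obtain ⟨i, hi, hQ⟩ := h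
    exact Or.inr ⟨Nat.findGreatest Q n, Nat.findGreatest_le n, Nat.findGreatest_spec hi hQ,
      fun j h1 h2 => Nat.findGreatest_is_greatest h1 h2⟩
  · push Not at h
    exact Or.inl h

/-- One row of reverse jeu de taquin: when a row `U` is put on top, either `x` stays in the row in
which it is, or an entry of `U` moves down and `x` reaches the row `U`. -/
theorem RevHole.step {T : Filling} {ν : List ℕ} {x : ℕ} {l r : List ℕ} {Bs : Filling}
    (h : RevHole T ν x l r Bs) {U : List ℕ} (hUT : IsTab (U :: T))
    (hn : (U :: T).flatten.Nodup) (hx : x ∉ (U :: T).flatten) (hν : IsPart (U.length :: ν)) :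
    (∃ T₁, IsTab T₁ ∧ shape T₁ = ν ∧ jdtDelete x T₁ = T ∧ T₁.flatten.Perm (x :: T.flatten) ∧
      Dom U (T₁.headD [])) ∨
    ∃ l' r' Bs', RevHole (U :: T) (U.length :: ν) x l' r' Bs' := by
  obtain ⟨hU0, hU, hd, hT⟩ := hUT
  rw [List.flatten_cons, List.nodup_append] at hn
  rw [List.flatten_cons, List.mem_append, not_or] at hx
  have hls := List.pairwise_append.1 h.hole.sorted
  have hlT : ∀ z ∈ l, z ∈ T.flatten := fun z hz => h.perm.mem_iff.1 (by simp [hz])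
  have hlen : l.length + 1 + r.length ≤ U.length := by
    have := h.shape_eq
    subst this
    exact (List.pairwise_cons.1 hν.1).1 _ (by simp)
  -- the rows of `T` and of the hole agree away from the hole
  have hR : ∀ i (hi : i < r.length), ∃ hi' : l.length + 1 + i < (T.headD []).length,
      (T.headD [])[l.length + 1 + i] = r[i] := by
    intro i hi
    rcases h.head with ⟨_, rfl, _⟩ | ⟨b, hb, _⟩
    · simp at hi
    · rw [hb]
      exact ⟨by simp; omega, getElem_append_cons_right _ _ _ _ hi _⟩
  have hL : ∀ i (hi : i < l.length), ∃ hi' : i < (T.headD []).length, (T.headD [])[i] = l[i] := by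
    intro i hi
    rcases h.head with ⟨hb, _, _⟩ | ⟨b, hb, _⟩
    · rw [hb]; exact ⟨hi, rfl⟩
    · rw [hb]; exact ⟨by simp; omega, List.getElem_append_left hi⟩
  have hUr : ∀ i (hi : i < r.length) (hi' : l.length + 1 + i < U.length),
      U[l.length + 1 + i] < r[i] := by
    intro i hi hi'
    obtain ⟨h1, h2⟩ := hR i hi
    exact h2 ▸ hd.2 _ h1 hi'
  have hUl : ∀ i (hi : i < l.length) (hi' : i < U.length), U[i] < l[i] := by
    intro i hi hi'
    obtain ⟨h1, h2⟩ := hL i hi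
    exact h2 ▸ hd.2 _ h1 hi'
  obtain ⟨a, d, rfl, ha, hc⟩ := exists_split hls.1
    (fun hxl => hx.2 (hlT x hxl))
  -- `x` would move up from column `i` if it got there and the entry above is `u`
  rcases forall_not_or_exists_greatest (fun i => ∃ hi : i < U.length, x < U[i] ∧
    ∀ j (hj : j < i) (hj' : j < (a ++ d).length), (a ++ d)[j] < U[i]) (a ++ d).length
    with hQ | ⟨q, hq, ⟨hqU, hxq, hjq⟩, hQ⟩
  · left
    obtain ⟨h1, h2, h3, h4⟩ := h.place ha hc
    refine ⟨_, h1, h2, h3, h4, ?_⟩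
    rw [List.headD_cons]
    simp only [List.length_append] at hlen hQ hUl hUr
    refine ⟨by simp only [List.length_append, List.length_cons]; omega, fun i hi hiU => ?_⟩
    simp only [List.length_append, List.length_cons] at hi
    rcases lt_trichotomy i a.length with hia | hia | hia
    · rw [List.getElem_append_left hia]
      have := hUl i (by omega) hiU
      rwa [List.getElem_append_left hia] at this
    · subst hia
      simp only [List.getElem_append_right le_rfl, Nat.sub_self, List.getElem_cons_zero]
      by_contra hle
      have hne : U[a.length] ≠ x := fun e => hx.1 (e ▸ List.getElem_mem hiU)
      refine hQ a.length (by omega) ⟨hiU, by omega, fun j hj hj' => ?_⟩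
      rw [List.getElem_append_left hj]
      have := ha _ (List.getElem_mem hj)
      omega
    · obtain ⟨j, rfl⟩ : ∃ j, i = a.length + 1 + j := ⟨i - a.length - 1, by omega⟩
      rw [getElem_append_cons_right _ _ _ _ (by simp; omega)]
      rcases Nat.lt_or_ge j d.length with hj | hj
      · rw [List.getElem_append_left hj]
        have hxc := hc _ (List.getElem_mem hj)
        by_contra hle
        refine hQ (a.length + 1 + j) (by omega) ⟨hiU, by omega, fun k hk hk' => ?_⟩
        have hk₂ : k < (a ++ d).length := by simp; omega
        have h5 : (a ++ d)[k] ≤ d[j] := by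
          have h6 : (a ++ d)[a.length + j]'(by simp; omega) = d[j] := by
            rw [List.getElem_append_right (by omega)]; simp
          rw [← h6]
          rcases Nat.lt_or_ge k (a.length + j) with h7 | h7
          · exact (List.pairwise_iff_getElem.1 hls.1 _ _ _ _ h7).le
          · have h8 : k = a.length + j := by omega
            subst h8; exact le_rfl
        have h9 : (a ++ d)[k] ≠ U[a.length + 1 + j] := fun e =>
          hn.2.2 _ (List.getElem_mem hiU) _ (hlT _ (List.getElem_mem hk₂)) e.symm
        omega
      · rw [List.getElem_append_right hj]
        have h5 := hUr (j - d.length) (by omega) (by omega)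
        convert h5 using 2
        omega
  · right
    generalize hl : a ++ d = l at *
    clear hl ha hc
    -- the entries of `U` to the right of column `q` would fit over the row shifted to the right
    have hQ' : ∀ i (hi : i < l.length) (hiU : i + 1 < U.length), q ≤ i → U[i + 1] < l[i] := by
      intro i hi hiU hqi
      by_contra hle
      have h1 := List.pairwise_iff_getElem.1 hU q (i + 1) hqU hiU (by omega)
      refine hQ (i + 1) (by omega) (by omega) ⟨hiU, by omega, fun k hk hk' => ?_⟩
      have h5 : l[k] ≤ l[i] := by
        rcases Nat.lt_or_ge k i with h7 | h7
        · exact (List.pairwise_iff_getElem.1 hls.1 _ _ _ _ h7).le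
        · have h8 : k = i := by omega
          subst h8; exact le_rfl
      have h9 : l[k] ≠ U[i + 1] := fun e =>
        hn.2.2 _ (List.getElem_mem hiU) _ (hlT _ (List.getElem_mem hk')) e.symm
      omega
    -- the entry of `T` below the entry which moves down
    have hqT : ∀ h' : q < (T.headD []).length, U[q] < (T.headD [])[q] := fun h' => hd.2 q h' hqU
    obtain ⟨s, t, rfl, rfl⟩ : ∃ s t, l = s ++ t ∧ s.length = q :=
      ⟨l.take q, l.drop q, by simp, by simp; omega⟩
    obtain ⟨lU, u, rU, rfl, hlU⟩ : ∃ lU u rU, U = lU ++ u :: rU ∧ lU.length = s.length :=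
      ⟨U.take s.length, U[s.length], U.drop (s.length + 1), by simp, by simp; omega⟩
    have hu : (lU ++ u :: rU)[s.length] = u := by simp [← hlU]
    rw [hu] at hxq hqT
    have hUs := List.pairwise_append.1 hU
    have hUr' := List.pairwise_cons.1 hUs.2.1
    simp only [List.length_append, List.length_cons] at hlen
    have hst := List.pairwise_append.1 hls.1
    have hsu : ∀ z ∈ s, z < u := by
      intro z hz
      obtain ⟨j, hj, rfl⟩ := List.getElem_of_mem hz
      have := hjq j hj (by simp; omega)
      rwa [hu, List.getElem_append_left hj] at this
    have hut : ∀ z ∈ t, u < z := by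
      intro z hz
      obtain ⟨j, hj, rfl⟩ := List.getElem_of_mem hz
      have h1 := hUl s.length (by simp; omega) hqU
      rw [hu, List.getElem_append_right le_rfl] at h1
      simp only [Nat.sub_self] at h1
      rcases Nat.eq_zero_or_pos j with rfl | hj0
      · exact h1
      · exact h1.trans (List.pairwise_iff_getElem.1 hst.2.1 0 j (by omega) hj hj0)
    have hur : ∀ z ∈ r, u < z := by
      intro z hz
      obtain ⟨j, hj, rfl⟩ := List.getElem_of_mem hz
      have h1 := hUr j hj (by simp; omega)
      refine lt_of_le_of_lt (le_of_lt ?_) h1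
      have h2 := List.pairwise_iff_getElem.1 hU s.length ((s ++ t).length + 1 + j) hqU
        (by simp; omega) (by simp; omega)
      rwa [hu] at h2
    have htab : IsTab ((s ++ u :: (t ++ r)) :: Bs) := by
      refine h.hole.moveLeft.isTab hsu (fun z hz => ?_) fun hB => ?_
      · exact (List.mem_append.1 hz).elim (hut z) (hur z)
      · cases t with
        | nil =>
          rcases h.head with ⟨_, _, h2⟩ | ⟨b, h1, h2⟩
          · simp only [List.append_nil] at h2; omega
          · simp only [List.append_nil] at h1 h2
            obtain ⟨h3, h4⟩ := List.getElem?_eq_some_iff.1 h2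
            have h5 := hqT (by rw [h1]; simp)
            simp only [h1, List.getElem_append_right le_rfl, Nat.sub_self,
              List.getElem_cons_zero] at h5
            omega
        | cons y t =>
          have h1 := h.hole.left s.length hB (by simp)
          simp only [List.getElem_append_right le_rfl, Nat.sub_self, List.getElem_cons_zero] at h1
          exact (hut y (by simp)).trans h1
    refine ⟨lU, rU, (s ++ u :: (t ++ r)) :: Bs, ⟨hU.sublist (by simp), ?_, fun i hi hil => ?_,
      fun i hi hir => ?_, htab⟩, ?_, ?_, ?_, fun z hz => hxq.trans (hUr'.1 z hz), fun hB => ?_,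
      Or.inr ⟨u, rfl, ?_⟩⟩
    · simp only [List.headD_cons, List.length_append, List.length_cons]; omega
    · simp only [List.headD_cons]
      have h1 := hUl i (by simp; omega) (by simp; omega)
      rw [List.getElem_append_left hil, List.getElem_append_left (by omega)] at h1
      rwa [List.getElem_append_left (by omega)]
    · simp only [List.headD_cons, List.length_append, List.length_cons] at hi
      have h3 := getElem_append_cons_right lU rU u i hir (by simp; omega)
      have h4 := getElem_append_cons_right s (t ++ r) u i (by simp; omega) (by simp; omega)
      simp only [List.headD_cons, hlU, h4]
      simp only [hlU] at h3
      rcases Nat.lt_or_ge i t.length with h5 | h5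
      · rw [List.getElem_append_left h5]
        have h6 := hQ' (s.length + i) (by simp; omega) (by simp; omega) (by omega)
        have h7 : (s ++ t)[s.length + i]'(by simp; omega) = t[i] := by
          rw [List.getElem_append_right (by omega)]; simp
        rw [← h3, ← h7]
        convert h6 using 2
        omega
      · rw [List.getElem_append_right h5, ← h3]
        have h6 := hUr (i - t.length) (by omega) (by simp; omega)
        convert h6 using 2
        simp only [List.length_append]; omega
    · rw [jdtSlide_down hlU.symm hUr'.1, h.hole.jdtSlide_moveLeft, h.slide]
    · rw [← h.shape_eq]; simp [shape]; omega
    · rw [List.flatten_cons, List.flatten_cons]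
      have h1 : (s ++ (u :: (t ++ r)) ++ Bs.flatten).Perm (u :: T.flatten) := by
        rw [List.append_assoc, List.cons_append]
        refine List.perm_middle.trans (List.Perm.cons _ ?_)
        simpa using h.perm
      refine (List.Perm.append_left _ h1).trans ?_
      simp only [List.append_assoc, List.cons_append]
      refine List.Perm.append_left _ ?_
      exact List.perm_middle
    · simpa [hlU] using hxq
    · simp [hlU]

/-- Reverse jeu de taquin from a new corner of `T` places `x` either below the first row, which then
stays as it is, or in the first row. -/
theorem exists_jdtDelete_eq_or {T : Filling} {ν : List ℕ} {x : ℕ} (hT : IsTab T)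
    (hn : T.flatten.Nodup) (hx : x ∉ T.flatten) (hν : IsPart ν) (h : AddsRow (shape T) ν) :
    (∃ T₁, IsTab T₁ ∧ shape T₁ = ν ∧ jdtDelete x T₁ = T ∧ T₁.flatten.Perm (x :: T.flatten) ∧
      T₁.headD [] = T.headD []) ∨ ∃ l r Bs, RevHole T ν x l r Bs := by
  induction T generalizing ν with
  | nil =>
    right
    cases h
    refine ⟨[], [], [], ⟨by simp, by simp, by simp, by simp, trivial⟩, ?_, rfl, by simp, by simp,
      by simp, by simp⟩
    rw [jdtSlide, if_pos rfl]
  | cons U T ih =>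
    generalize hμ : shape (U :: T) = μ at h
    cases h with
    | new => simp [shape] at hμ
    | here a μ =>
      simp only [shape, List.map_cons, List.cons.injEq] at hμ
      obtain ⟨rfl, rfl⟩ := hμ
      right
      have hd := hT.2.2.1
      exact ⟨U, [], T, ⟨by simpa using hT.2.1, by have := hd.1; simp only [List.length_nil]; omega,
        fun i h1 h2 => hd.2 i h1 h2, by simp, hT.2.2.2⟩, jdtSlide_stop hT.1 hd.1, rfl, by simp,
        by simp, fun hB => absurd hd.1 (not_le.2 hB), Or.inl ⟨rfl, rfl, hd.1⟩⟩
    | lower a h =>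
      rename_i μ ν
      simp only [shape, List.map_cons, List.cons.injEq] at hμ
      obtain ⟨rfl, rfl⟩ := hμ
      have hn' := hn
      have hx' := hx
      rw [List.flatten_cons, List.nodup_append] at hn
      rw [List.flatten_cons, List.mem_append, not_or] at hx
      have lift : (∃ T₁, IsTab T₁ ∧ shape T₁ = ν ∧ jdtDelete x T₁ = T ∧
          T₁.flatten.Perm (x :: T.flatten) ∧ Dom U (T₁.headD [])) →
          ∃ T₁, IsTab T₁ ∧ shape T₁ = U.length :: ν ∧ jdtDelete x T₁ = U :: T ∧
            T₁.flatten.Perm (x :: (U :: T).flatten) ∧ T₁.headD [] = (U :: T).headD [] := by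
        rintro ⟨T₁, h1, h2, h3, h4, h5⟩
        refine ⟨U :: T₁, ⟨hT.1, hT.2.1, h5, h1⟩, by simp [shape] at h2 ⊢; exact h2,
          by rw [jdtDelete, if_neg hx.1, h3], ?_, rfl⟩
        rw [List.flatten_cons, List.flatten_cons]
        exact (List.Perm.append_left _ h4).trans List.perm_middle
      rcases ih hT.2.2.2 hn.2.1 hx.2 hν.tail h with ⟨T₁, h1, h2, h3, h4, h5⟩ | ⟨l, r, Bs, hr⟩
      · exact Or.inl (lift ⟨T₁, h1, h2, h3, h4, h5 ▸ hT.2.2.1⟩)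
      · exact (hr.step hT hn' hx' hν).imp_left lift

/-- Jeu de taquin can be undone: for every tableau, every new entry and every new corner there is
a tableau with this corner from which removing the entry gives the original tableau. -/
theorem exists_jdtDelete_eq {T : Filling} {ν : List ℕ} {x : ℕ} (hT : IsTab T)
    (hn : T.flatten.Nodup) (hx : x ∉ T.flatten) (hν : IsPart ν) (h : AddsRow (shape T) ν) :
    ∃ T₁, IsTab T₁ ∧ shape T₁ = ν ∧ jdtDelete x T₁ = T ∧ T₁.flatten.Perm (x :: T.flatten) := by
  rcases exists_jdtDelete_eq_or hT hn hx hν h with ⟨T₁, h1, h2, h3, h4, _⟩ | ⟨l, r, Bs, hr⟩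
  · exact ⟨T₁, h1, h2, h3, h4⟩
  · obtain ⟨a, c, rfl, ha, hc⟩ := exists_split (List.pairwise_append.1 hr.hole.sorted).1
      (fun hxl => hx (hr.perm.mem_iff.1 (List.mem_append_left _ (List.mem_append_left _ hxl))))
    exact ⟨_, hr.place ha hc⟩

/-! ### The delete-insert process -/

/-- `T` is a standard Young tableau with entries `1, …, m`. -/
def IsStd (m : ℕ) (T : Filling) : Prop := IsTab T ∧ T.flatten.Perm (List.range' 1 m)

theorem IsStd.nodup {m : ℕ} {T : Filling} (h : IsStd m T) : T.flatten.Nodup :=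
  h.2.nodup_iff.2 List.nodup_range'

theorem IsStd.mem_iff {m : ℕ} {T : Filling} (h : IsStd m T) (x : ℕ) :
    x ∈ T.flatten ↔ 1 ≤ x ∧ x ≤ m := by
  rw [h.2.mem_iff, List.mem_range'_1]; omega

theorem isStd_range' {m : ℕ} (hm : 0 < m) : IsStd m [List.range' 1 m] :=
  ⟨⟨by simp; omega, List.pairwise_lt_range', dom_nil _, trivial⟩, by simp⟩

/-- The delete-insert process `diTableau` for a sequence indexed by all natural numbers, which thus
never stops. -/
def di (m : ℕ) (f : ℕ → ℕ) : ℕ → Filling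
  | 0 => [List.range' 1 m]
  | t + 1 => if t % 2 = 0 then jdtDelete (f (t / 2)) (di m f t) else rskInsert (f (t / 2)) (di m f t)

theorem di_odd (m : ℕ) (f : ℕ → ℕ) (j : ℕ) :
    di m f (2 * j + 1) = jdtDelete (f j) (di m f (2 * j)) := by
  rw [di, if_pos (by omega)]; congr; omega

theorem di_even (m : ℕ) (f : ℕ → ℕ) (j : ℕ) :
    di m f (2 * j + 2) = rskInsert (f j) (di m f (2 * j + 1)) := by
  rw [di, if_neg (by omega)]; congr; omega

theorem di_congr {m : ℕ} {f g : ℕ → ℕ} {k : ℕ} (h : ∀ j < k, f j = g j) {t : ℕ}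
    (ht : t ≤ 2 * k) : di m f t = di m g t := by
  induction t with
  | zero => rfl
  | succ t ih => rw [di, di, ih (by omega), h (t / 2) (by omega)]

theorem diTableau_eq_di {m k : ℕ} {i : Fin k → ℕ+} {f : ℕ → ℕ} (h : ∀ j : Fin k, (i j : ℕ) = f j)
    {t : ℕ} (ht : t ≤ 2 * k) : diTableau m i t = di m f t := by
  induction t with
  | zero => rfl
  | succ t ih =>
    rw [diTableau, di, dif_pos (by omega), ih (by omega), h]

theorem IsStd.jdtDelete {m x : ℕ} {T : Filling} (h : IsStd m T) (hx : 1 ≤ x ∧ x ≤ m) :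
    IsTab (jdtDelete x T) ∧ T.flatten.Perm (x :: (Vacillating.jdtDelete x T).flatten) ∧
      AddsRow (shape (Vacillating.jdtDelete x T)) (shape T) ∧
      (Vacillating.jdtDelete x T).flatten.Nodup ∧ x ∉ (Vacillating.jdtDelete x T).flatten := by
  obtain ⟨h1, h2, h3, _⟩ := jdtDelete_spec h.1 h.nodup ((h.mem_iff x).2 hx)
  have := List.nodup_cons.1 (h2.nodup_iff.1 h.nodup)
  exact ⟨h1, h2, h3, this.2, this.1⟩

theorem IsStd.rskInsert_jdtDelete {m x : ℕ} {T : Filling} (h : IsStd m T) (hx : 1 ≤ x ∧ x ≤ m) :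
    IsStd m (rskInsert x (Vacillating.jdtDelete x T)) ∧ AddsRow (shape (Vacillating.jdtDelete x T))
      (shape (rskInsert x (Vacillating.jdtDelete x T))) := by
  obtain ⟨h1, h2, _, h4, h5⟩ := h.jdtDelete hx
  obtain ⟨h6, h7, h8⟩ := rskInsert_spec h1 h4 h5
  exact ⟨⟨h6, h7.trans (h2.symm.trans h.2)⟩, h8⟩

theorem isStd_di {m k : ℕ} {f : ℕ → ℕ} (hm : 0 < m) (hf : ∀ j < k, 1 ≤ f j ∧ f j ≤ m) {j : ℕ}
    (hj : j ≤ k) : IsStd m (di m f (2 * j)) := by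
  induction j with
  | zero => exact isStd_range' hm
  | succ j ih =>
    rw [show 2 * (j + 1) = 2 * j + 2 by ring, di_even, di_odd]
    exact ((ih (by omega)).rskInsert_jdtDelete (hf j (by omega))).1

/-! ### Prolonging the first row -/

/-- The tableau `T` with an entry `M` appended to its first row, which is created if `T` is empty. -/
def extend (M : ℕ) : Filling → Filling
  | [] => [[M]]
  | R :: Rs => (R ++ [M]) :: Rs

theorem tail_shape_extend (M : ℕ) (T : Filling) : (shape (extend M T)).tail = (shape T).tail := by
  cases T <;> rfl

theorem rskInsert_extend {T : Filling} {x M : ℕ} (hT : IsTab T) (hx : x ∉ T.flatten)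
    (hM : ∀ z ∈ T.flatten, z < M) (hy : ∃ y ∈ T.headD [], x < y) :
    rskInsert x (extend M T) = extend M (rskInsert x T) := by
  obtain ⟨y, hy, hxy⟩ := hy
  cases T with
  | nil => simp at hy
  | cons R Rs =>
    have hx' : x ∉ R := fun h => hx (by rw [List.flatten_cons]; exact List.mem_append_left _ h)
    rcases append_or_bump hT.2.1 hx' with h | ⟨u, w, v, rfl, h1, h2⟩
    · have := h y hy; omega
    · have hs : (u ++ w :: (v ++ [M])).Pairwise (· < ·) := by
        rw [show u ++ w :: (v ++ [M]) = (u ++ w :: v) ++ [M] by simp, List.pairwise_append]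
        refine ⟨hT.2.1, by simp, fun z hz z' hz' => ?_⟩
        rw [List.mem_singleton.1 hz']
        exact hM z (by rw [List.flatten_cons]; exact List.mem_append_left _ hz)
      rw [rskInsert_bump hT.2.1 h1 h2, extend, extend]
      have := rskInsert_bump hs h1 h2 Rs
      simpa using this

theorem jdtSlide_extend {l r : List ℕ} {Bs : Filling} {M : ℕ} (h : IsHole l r Bs)
    (hlen : (Bs.headD []).length ≤ l.length + r.length)
    (hM : ∀ z ∈ (Bs.headD []), z < M) (hn : (l ++ r ++ Bs.flatten).Nodup) :
    jdtSlide l (r ++ [M]) Bs = extend M (jdtSlide l r Bs) := by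
  induction r generalizing l with
  | nil =>
    rw [List.nil_append, jdtSlide_right, jdtSlide_stop (by simp)]
    · by_cases hl : l = []
      · subst hl
        cases Bs with
        | nil => rw [jdtSlide, if_pos rfl]; rfl
        | cons B Bs => exact absurd (by simpa using hlen) h.tab.1
      · rw [jdtSlide_stop hl (by simpa using hlen)]; rfl
    · simp only [List.length_append, List.length_nil] at hlen ⊢; omega
    · intro b hb
      obtain ⟨h1, _⟩ := List.getElem?_eq_some_iff.1 hb
      simp only [List.length_nil] at hlen; omega
  | cons a r ih =>
    by_cases hc : ∀ hl : l.length < (Bs.headD []).length, a < (Bs.headD [])[l.length]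
    · have hb : ∀ b, (Bs.headD [])[l.length]? = some b → a < b := by
        intro b hb
        obtain ⟨hl, rfl⟩ := List.getElem?_eq_some_iff.1 hb
        exact hc hl
      rw [List.cons_append, jdtSlide_right hb, jdtSlide_right hb]
      refine ih (h.moveRight hc) ?_ (by simpa using hn)
      simp only [List.length_append, List.length_cons, List.length_nil] at hlen ⊢; omega
    · push Not at hc
      obtain ⟨hl, hc⟩ := hc
      cases Bs with
      | nil => simp at hl
      | cons B Bs =>
        simp only [List.headD_cons] at hl hc hM
        obtain ⟨l', r', e, e'⟩ : ∃ l' r', B = l' ++ B[l.length] :: r' ∧ l'.length = l.length :=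
          ⟨B.take l.length, B.drop (l.length + 1), by simp, by simp; omega⟩
        have hbM := hM _ (List.getElem_mem hl)
        generalize B[l.length] = b at e hc hbM
        subst e
        have hba : b ≠ a := by
          rintro rfl
          simp [List.nodup_append] at hn
        have hs := List.pairwise_cons.1 (List.pairwise_append.1 h.sorted).2.1
        have hr : ∀ z ∈ a :: r, b < z := by
          intro z hz
          rcases List.mem_cons.1 hz with rfl | hz
          · omega
          · have := hs.1 z hz; omega
        rw [jdtSlide_down e' hr, jdtSlide_down e', extend]
        · simp
        · intro z hz
          rcases List.mem_append.1 hz with hz | hz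
          · exact hr z hz
          · rw [List.mem_singleton.1 hz]; exact hbM

theorem jdtDelete_extend {T : Filling} {x M : ℕ} (hT : IsTab T) (hn : T.flatten.Nodup)
    (hx : x ∈ T.flatten) (hM : ∀ z ∈ T.flatten, z < M)
    (hlen : (T.tail.headD []).length < (T.headD []).length) :
    jdtDelete x (extend M T) = extend M (jdtDelete x T) := by
  cases T with
  | nil => simp at hx
  | cons R Rs =>
    rw [extend]
    by_cases hxR : x ∈ R
    · obtain ⟨l, r, rfl⟩ := List.append_of_mem hxR
      have hs := List.pairwise_append.1 hT.2.1
      have hxl : x ∉ l := fun h => lt_irrefl x (hs.2.2 x h x (by simp))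
      rw [jdtDelete_mem hxl, List.append_assoc, List.cons_append, jdtDelete_mem hxl]
      refine jdtSlide_extend (IsHole.of_isTab hT) ?_ (fun z hz => hM z ?_) ?_
      · simp only [List.tail_cons, List.headD_cons, List.length_append, List.length_cons] at hlen
        omega
      · rw [List.flatten_cons]
        exact List.mem_append_right _ (mem_flatten_of_mem_headD hz)
      · refine hn.sublist ?_
        rw [List.flatten_cons]
        exact List.Sublist.append_right (by simp) _
    · have hxM : x ≠ M := (hM x hx).ne
      rw [jdtDelete, if_neg (by simp [hxR, hxM]), jdtDelete, if_neg hxR]; rfl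

/-- In the tableau `T`, removal of `x` is not affected by further entries at the end of the first
row, and insertion of `x` afterwards bumps an entry from the first row. -/
def StableStep (T : Filling) (x : ℕ) : Prop :=
  (T.tail.headD []).length < (T.headD []).length ∧ ∃ y ∈ (jdtDelete x T).headD [], x < y

/-- All the steps of the process for the first `k` entries of `f` are stable. -/
def Stable (m : ℕ) (f : ℕ → ℕ) (k : ℕ) : Prop :=
  ∀ j < k, (1 ≤ f j ∧ f j ≤ m) ∧ StableStep (di m f (2 * j)) (f j)

theorem StableStep.jdtDelete_extend {m x : ℕ} {T : Filling} (hT : IsStd m T) (hx : 1 ≤ x ∧ x ≤ m)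
    (h : StableStep T x) : jdtDelete x (extend (m + 1) T) = extend (m + 1) (jdtDelete x T) :=
  Vacillating.jdtDelete_extend hT.1 hT.nodup ((hT.mem_iff x).2 hx)
    (fun z hz => by have := (hT.mem_iff z).1 hz; omega) h.1

theorem StableStep.rskInsert_extend {m x : ℕ} {T : Filling} (hT : IsStd m T) (hx : 1 ≤ x ∧ x ≤ m)
    (h : StableStep T x) : rskInsert x (extend (m + 1) (jdtDelete x T)) =
      extend (m + 1) (rskInsert x (jdtDelete x T)) := by
  obtain ⟨h1, h2, _, h4, h5⟩ := hT.jdtDelete hx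
  refine Vacillating.rskInsert_extend h1 h5 (fun z hz => ?_) h.2
  have := (hT.mem_iff z).1 (h2.mem_iff.2 (List.mem_cons_of_mem _ hz))
  omega

theorem StableStep.extend {m x : ℕ} {T : Filling} (hT : IsStd m T) (hx : 1 ≤ x ∧ x ≤ m)
    (h : StableStep T x) : StableStep (extend (m + 1) T) x := by
  refine ⟨?_, ?_⟩
  · have := h.1
    cases T with
    | nil => simp at this
    | cons R Rs =>
      simp only [Vacillating.extend, List.tail_cons, List.headD_cons, List.length_append] at this ⊢
      omega
  · rw [h.jdtDelete_extend hT hx]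
    obtain ⟨y, hy, hxy⟩ := h.2
    refine ⟨y, ?_, hxy⟩
    cases hT' : jdtDelete x T with
    | nil => simp [hT'] at hy
    | cons R Rs =>
      simp only [hT', List.headD_cons] at hy
      simp [Vacillating.extend, hy]

/-- In a stable process, the tableaux for `m + 1` are those for `m` with the entry `m + 1` appended to
the first row. -/
theorem Stable.di_succ {m k : ℕ} {f : ℕ → ℕ} (hm : 0 < m) (h : Stable m f k) {t : ℕ}
    (ht : t ≤ 2 * k) : di (m + 1) f t = extend (m + 1) (di m f t) := by
  induction t with
  | zero => simp [di, extend, List.range'_1_concat, Nat.add_comm]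
  | succ t ih =>
    have hj : t / 2 < k := by omega
    obtain ⟨h1, h2⟩ := h (t / 2) hj
    have h3 := isStd_di hm (fun j hj => (h j hj).1) hj.le
    rcases Nat.mod_two_eq_zero_or_one t with h0 | h0
    · obtain ⟨j, rfl⟩ : ∃ j, t = 2 * j := ⟨t / 2, by omega⟩
      rw [show 2 * j / 2 = j by omega] at *
      rw [di_odd, di_odd, ih (by omega), h2.jdtDelete_extend h3 h1]
    · obtain ⟨j, rfl⟩ : ∃ j, t = 2 * j + 1 := ⟨t / 2, by omega⟩
      rw [show (2 * j + 1) / 2 = j by omega] at *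
      rw [di_even, di_even, ih (by omega), di_odd, h2.rskInsert_extend h3 h1]

theorem Stable.succ {m k : ℕ} {f : ℕ → ℕ} (hm : 0 < m) (h : Stable m f k) :
    Stable (m + 1) f k := by
  intro j hj
  obtain ⟨h1, h2⟩ := h j hj
  refine ⟨⟨h1.1, by omega⟩, ?_⟩
  rw [h.di_succ hm (by omega)]
  exact h2.extend (isStd_di hm (fun j hj => (h j hj).1) hj.le) h1

/-- A stable process yields the same shapes below the first row for all larger `m`. -/
theorem Stable.tail_shape {m k : ℕ} {f : ℕ → ℕ} (hm : 0 < m) (h : Stable m f k) {m' : ℕ}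
    (hm' : m ≤ m') {t : ℕ} (ht : t ≤ 2 * k) :
    (shape (di m' f t)).tail = (shape (di m f t)).tail := by
  have key : Stable m' f k ∧ (shape (di m' f t)).tail = (shape (di m f t)).tail := by
    induction m', hm' using Nat.le_induction with
    | base => exact ⟨h, rfl⟩
    | succ n hn ih =>
      refine ⟨ih.1.succ (by omega), ?_⟩
      rw [ih.1.di_succ (by omega) ht, tail_shape_extend, ih.2]
  exact key.2

/-! ### Sizes of the rows -/

theorem AddsRow.sum_eq {μ ν : List ℕ} (h : AddsRow μ ν) : ν.sum = μ.sum + 1 := by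
  induction h with
  | new => rfl
  | here a μ => simp; omega
  | lower a h ih => simp [ih]; omega

theorem AddsRow.tail_sum {μ ν : List ℕ} (h : AddsRow μ ν) :
    μ.tail.sum ≤ ν.tail.sum ∧ ν.tail.sum ≤ μ.tail.sum + 1 := by
  cases h with
  | new => simp
  | here a μ => simp
  | lower a h => simp [h.sum_eq]

theorem AddsRow.tail {μ ν : List ℕ} (h : AddsRow μ ν) : μ.tail = ν.tail ∨ AddsRow μ.tail ν.tail := by
  cases h with
  | new => exact Or.inl rfl
  | here a μ => exact Or.inl rfl
  | lower a h => exact Or.inr h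

theorem IsTab.isPart {T : Filling} (h : IsTab T) : IsPart (shape T) := by
  induction T with
  | nil => exact ⟨by simp [shape], by simp [shape]⟩
  | cons R Rs ih =>
    obtain ⟨h1, h2⟩ := ih h.2.2.2
    have hR : 0 < R.length := List.length_pos_of_ne_nil h.1
    refine ⟨?_, ?_⟩
    · change (R.length :: shape Rs).Pairwise _
      rw [List.pairwise_cons]
      refine ⟨fun a ha => ?_, h1⟩
      cases Rs with
      | nil => simp [shape] at ha
      | cons B Bs =>
        have hB : B.length ≤ R.length := h.2.2.1.1
        rcases List.mem_cons.1 ha with rfl | ha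
        · exact hB
        · exact le_trans ((List.pairwise_cons.1 h1).1 a ha) hB
    · intro a ha
      rcases List.mem_cons.1 ha with rfl | ha
      · exact hR
      · exact h2 a ha

theorem IsPart.of_tail {μ : List ℕ} (h : IsPart μ) : IsPart μ.tail := by
  cases μ with
  | nil => exact h
  | cons a μ => exact h.tail

theorem length_flatten_eq (T : Filling) :
    T.flatten.length = (T.headD []).length + (shape T).tail.sum := by
  cases T <;> simp [shape]

theorem length_second_row_le (T : Filling) :
    (T.tail.headD []).length ≤ (shape T).tail.sum := by
  cases T with
  | nil => simp
  | cons R Rs => cases Rs <;> simp [shape]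

theorem exists_mem_gt_of_length {R : List ℕ} {n : ℕ} (hs : R.Pairwise (· < ·))
    (hp : ∀ z ∈ R, 1 ≤ z) (hn : n < R.length) : ∃ y ∈ R, n < y := by
  have key : ∀ i (hi : i < R.length), i < R[i] := by
    intro i
    induction i with
    | zero => intro hi; exact hp _ (List.getElem_mem hi)
    | succ i ih =>
      intro hi
      have := ih (by omega)
      have := List.pairwise_iff_getElem.1 hs i (i + 1) (by omega) hi (by omega)
      omega
  exact ⟨R[n], List.getElem_mem hn, key n hn⟩

theorem tail_sum_di_le {m k : ℕ} {f : ℕ → ℕ} (hm : 0 < m) (hf : ∀ j < k, 1 ≤ f j ∧ f j ≤ m)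
    {j : ℕ} (hj : j ≤ k) : (shape (di m f (2 * j))).tail.sum ≤ j := by
  induction j with
  | zero => simp [di, shape]
  | succ j ih =>
    have hT := isStd_di hm hf (show j ≤ k by omega)
    have h1 := (hT.jdtDelete (hf j hj)).2.2.1.tail_sum.1
    have h2 := (hT.rskInsert_jdtDelete (hf j hj)).2.tail_sum.2
    have := ih (by omega)
    rw [show 2 * (j + 1) = 2 * j + 2 by ring, di_even, di_odd]
    omega

/-- The process is stable once `m` is large compared with the entries and the length of
the sequence: at most `k` entries lie below the first row, so this row is longer than the second
one and has entries greater than those to be inserted. -/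
theorem stable_of_lt {m n k : ℕ} {f : ℕ → ℕ} (hf : ∀ j < k, 1 ≤ f j ∧ f j ≤ n)
    (hm : n + 2 * k < m) : Stable m f k := by
  have hf' : ∀ j < k, 1 ≤ f j ∧ f j ≤ m := fun j hj => ⟨(hf j hj).1, by have := hf j hj; omega⟩
  intro j hj
  have hT := isStd_di (by omega) hf' hj.le
  have hsum := tail_sum_di_le (by omega) hf' hj.le
  obtain ⟨h1, h2, h3, h4, h5⟩ := hT.jdtDelete (hf' j hj)
  have hl := length_flatten_eq (di m f (2 * j))
  rw [hT.2.length_eq, List.length_range'] at hl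
  have hl2 := length_second_row_le (di m f (2 * j))
  have hl3 := length_flatten_eq (jdtDelete (f j) (di m f (2 * j)))
  have hl4 := h2.length_eq
  rw [hT.2.length_eq, List.length_range', List.length_cons] at hl4
  have hl5 := h3.tail_sum.1
  refine ⟨hf' j hj, by omega, ?_⟩
  obtain ⟨y, hy, hny⟩ := exists_mem_gt_of_length (n := n) h1.pairwise_headD (fun z hz =>
    ((hT.mem_iff z).1 (h2.mem_iff.2 (List.mem_cons_of_mem _ (mem_flatten_of_mem_headD hz)))).1)
    (by omega)
  exact ⟨y, hy, (hf j hj).2.trans_lt hny⟩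

/-- In a stable step, the box added by the insertion lies below the first row. -/
theorem StableStep.addsRow_tail {m x : ℕ} {T : Filling} (hT : IsStd m T) (hx : 1 ≤ x ∧ x ≤ m)
    (h : StableStep T x) : AddsRow (shape (jdtDelete x T)).tail
      (shape (rskInsert x (jdtDelete x T))).tail := by
  obtain ⟨h1, _, _, h4, h5⟩ := hT.jdtDelete hx
  obtain ⟨y, hy, hxy⟩ := h.2
  generalize jdtDelete x T = S at *
  cases S with
  | nil => simp at hy
  | cons R Rs =>
    rw [List.flatten_cons, List.nodup_append] at h4
    rw [List.flatten_cons, List.mem_append, not_or] at h5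
    rcases append_or_bump h1.2.1 h5.1 with h | ⟨u, w, v, rfl, h6, h7⟩
    · have := h y hy; omega
    · rw [rskInsert_bump h1.2.1 h6 h7]
      exact (rskInsert_spec h1.2.2.2 h4.2.1 (fun hw => h4.2.2 w (by simp) w hw rfl)).2.2

/-! ### Young diagrams and lists of row lengths -/

theorem isPart_rowLens (μ : YoungDiagram) : IsPart μ.rowLens :=
  ⟨μ.rowLens_sorted.pairwise, μ.pos_of_mem_rowLens⟩

theorem IsPart.exists_rowLens_eq {μ : List ℕ} (h : IsPart μ) :
    ∃ Y : YoungDiagram, Y.rowLens = μ :=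
  ⟨YoungDiagram.ofRowLens μ h.1.sortedGE, YoungDiagram.rowLens_ofRowLens_eq_self h.2⟩

theorem rowLens_injective : Function.Injective YoungDiagram.rowLens := by
  intro μ ν h
  rw [← YoungDiagram.ofRowLens_to_rowLens_eq_self (μ := μ),
    ← YoungDiagram.ofRowLens_to_rowLens_eq_self (μ := ν)]
  congr 1

theorem getD_rowLens (μ : YoungDiagram) (s : ℕ) : μ.rowLens.getD s 0 = μ.rowLen s := by
  by_cases h : s < μ.rowLens.length
  · rw [List.getD_eq_getElem _ _ h, YoungDiagram.get_rowLens]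
  · rw [List.getD_eq_default _ _ (by omega)]
    rw [YoungDiagram.length_rowLens, ← YoungDiagram.mem_iff_lt_colLen,
      YoungDiagram.mem_iff_lt_rowLen] at h
    omega

theorem addsBox_iff_rowLen {μ ν : YoungDiagram} :
    AddsBox μ ν ↔ ∃ r, ∀ s, ν.rowLen s = μ.rowLen s + if s = r then 1 else 0 := by
  constructor
  · rintro ⟨⟨r, c⟩, hc, h⟩
    refine ⟨r, fun s => ?_⟩
    have h1 : ∀ j, j < ν.rowLen s ↔ (s = r ∧ j = c) ∨ j < μ.rowLen s := by
      intro j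
      rw [← YoungDiagram.mem_iff_lt_rowLen, ← YoungDiagram.mem_iff_lt_rowLen,
        ← YoungDiagram.mem_cells, h, Finset.mem_insert, YoungDiagram.mem_cells, Prod.mk.injEq]
    rw [YoungDiagram.mem_cells, YoungDiagram.mem_iff_lt_rowLen] at hc
    split_ifs with hs
    · subst hs
      have h2 := (h1 c).2 (Or.inl ⟨rfl, rfl⟩)
      have h3 := h1 (μ.rowLen s)
      have h4 := h1 (c + 1)
      have h5 := h1 (μ.rowLen s + 1)
      simp only [true_and] at h3 h4 h5
      -- `c = μ.rowLen s`, as the row `s` of `ν` has no gap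
      omega
    · have h2 := h1 (μ.rowLen s)
      have h3 := h1 (ν.rowLen s)
      simp only [hs, false_and, false_or] at h2 h3
      omega
  · rintro ⟨r, h⟩
    refine ⟨(r, μ.rowLen r), ?_, ?_⟩
    · rw [YoungDiagram.mem_cells, YoungDiagram.mem_iff_lt_rowLen]; omega
    · ext ⟨i, j⟩
      rw [Finset.mem_insert, YoungDiagram.mem_cells, YoungDiagram.mem_cells,
        YoungDiagram.mem_iff_lt_rowLen, YoungDiagram.mem_iff_lt_rowLen, h i, Prod.mk.injEq]
      split_ifs with hi
      · subst hi; simp only [true_and]; omega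
      · simp [hi]

theorem IsPart.eq_nil {μ : List ℕ} (h : IsPart μ) (h0 : ∀ s, μ.getD s 0 = 0) : μ = [] := by
  cases μ with
  | nil => rfl
  | cons a μ =>
    have h1 := h.2 a (by simp)
    have h2 := h0 0
    simp at h2; omega

theorem IsPart.ext {μ ν : List ℕ} (hμ : IsPart μ) (hν : IsPart ν)
    (h : ∀ s, μ.getD s 0 = ν.getD s 0) : μ = ν := by
  induction μ generalizing ν with
  | nil => exact (hν.eq_nil (fun s => by rw [← h s]; simp)).symm
  | cons a μ ih =>
    cases ν with
    | nil => exact hμ.eq_nil (fun s => by rw [h s]; simp)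
    | cons b ν =>
      have h0 := h 0
      simp only [List.getD_cons_zero] at h0
      rw [h0, ih hμ.tail hν.tail fun s => by simpa using h (s + 1)]

theorem addsRow_iff_getD {μ ν : List ℕ} (hμ : IsPart μ) (hν : IsPart ν) :
    AddsRow μ ν ↔ ∃ r, ∀ s, ν.getD s 0 = μ.getD s 0 + if s = r then 1 else 0 := by
  constructor
  · intro h
    clear hμ hν
    induction h with
    | new => exact ⟨0, fun s => by cases s <;> simp⟩
    | here a μ => exact ⟨0, fun s => by cases s <;> simp⟩
    | lower a h ih =>
      obtain ⟨r, hr⟩ := ih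
      refine ⟨r + 1, fun s => ?_⟩
      cases s with
      | zero => simp
      | succ s => simpa using hr s
  · rintro ⟨r, h⟩
    induction μ generalizing ν r with
    | nil =>
      cases ν with
      | nil => simpa using h r
      | cons b ν =>
        have hb := hν.2 b (by simp)
        have h0 := h 0
        simp only [List.getD_cons_zero, List.getD_nil] at h0
        have hr : 0 = r := by by_contra hr; rw [if_neg hr] at h0; omega
        subst hr
        have : ν = [] := hν.tail.eq_nil fun s => by simpa using h (s + 1)
        subst this
        rw [if_pos rfl] at h0
        rw [h0]; exact AddsRow.new
    | cons a μ ih =>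
      have ha := hμ.2 a (by simp)
      cases ν with
      | nil => have := h 0; simp at this; omega
      | cons b ν =>
        have h0 := h 0
        simp only [List.getD_cons_zero] at h0
        cases r with
        | zero =>
          rw [if_pos rfl] at h0
          have : ν = μ := hν.tail.ext hμ.tail fun s => by simpa using h (s + 1)
          rw [h0, this]; exact AddsRow.here a μ
        | succ r =>
          rw [if_neg (by omega), Nat.add_zero] at h0
          rw [h0]
          exact AddsRow.lower a (ih hμ.tail hν.tail r fun s => by simpa using h (s + 1))

theorem addsBox_iff_addsRow {μ ν : YoungDiagram} :
    AddsBox μ ν ↔ AddsRow μ.rowLens ν.rowLens := by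
  rw [addsBox_iff_rowLen, addsRow_iff_getD (isPart_rowLens μ) (isPart_rowLens ν)]
  simp only [getD_rowLens]

theorem rowLens_bot : (⊥ : YoungDiagram).rowLens = [] := by
  refine (isPart_rowLens _).eq_nil fun s => ?_
  rw [getD_rowLens]
  by_contra h
  exact YoungDiagram.notMem_bot (s, 0) (YoungDiagram.mem_iff_lt_rowLen.2 (by omega))

/-! ### Running the process backwards -/

/-- The tableau with the consecutive numbers from `s` on filled in row by row. -/
theorem exists_isTab_flatten_eq_range' {μ : List ℕ} (hμ : IsPart μ) (s : ℕ) :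
    ∃ T, IsTab T ∧ shape T = μ ∧ T.flatten = List.range' s μ.sum := by
  induction μ generalizing s with
  | nil => exact ⟨[], trivial, rfl, rfl⟩
  | cons a μ ih =>
    have ha := hμ.2 a (by simp)
    obtain ⟨T, h1, h2, h3⟩ := ih hμ.tail (s + a)
    have hT : ∀ z ∈ T.headD [], s + a ≤ z := by
      intro z hz
      have := mem_flatten_of_mem_headD hz
      rw [h3, List.mem_range'_1] at this
      exact this.1
    refine ⟨List.range' s a :: T, ⟨by simp; omega, List.pairwise_lt_range', ⟨?_, ?_⟩, h1⟩, ?_, ?_⟩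
    · rw [List.length_range']
      subst h2
      exact hμ.headD_le
    · intro i h4 h5
      have := hT _ (List.getElem_mem h4)
      rw [List.length_range'] at h5
      rw [List.getElem_range']; omega
    · simp only [shape, List.map_cons, List.length_range']
      rw [← h2]; rfl
    · rw [List.flatten_cons, h3, List.sum_cons, List.range'_append_1]

theorem exists_isStd {μ : List ℕ} (hμ : IsPart μ) {m : ℕ} (hm : μ.sum = m) :
    ∃ T, IsStd m T ∧ shape T = μ := by
  obtain ⟨T, h1, h2, h3⟩ := exists_isTab_flatten_eq_range' hμ 1
  exact ⟨T, ⟨h1, by rw [h3, hm]⟩, h2⟩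

theorem IsStd.eq_range' {m : ℕ} {T : Filling} (h : IsStd m T) (hs : shape T = [m]) :
    T = [List.range' 1 m] := by
  match T, hs with
  | [R], hs =>
    have h1 : R.Perm (List.range' 1 m) := by simpa using h.2
    rw [List.Perm.eq_of_pairwise' (h.1.2.1) List.pairwise_lt_range' h1]

/-- Every standard tableau is the result of a process whose shapes are prescribed, as long as each
step removes or adds a box in these shapes. -/
theorem exists_di_eq {m k : ℕ} {Λ : ℕ → List ℕ} (h0 : Λ 0 = [m]) (hΛ : ∀ t ≤ 2 * k, IsPart (Λ t))
    (hs : ∀ j < k, AddsRow (Λ (2 * j + 1)) (Λ (2 * j)) ∧ AddsRow (Λ (2 * j + 1)) (Λ (2 * j + 2)))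
    {T : Filling} (hT : IsStd m T) (hTs : shape T = Λ (2 * k)) :
    ∃ f : ℕ → ℕ, (∀ j < k, 1 ≤ f j ∧ f j ≤ m) ∧ di m f (2 * k) = T ∧
      ∀ t ≤ 2 * k, shape (di m f t) = Λ t := by
  induction k generalizing T with
  | zero =>
    refine ⟨fun _ => 1, by simp, (hT.eq_range' (hTs.trans h0)).symm, fun t ht => ?_⟩
    obtain rfl : t = 0 := by omega
    rw [h0]; simp [di, shape]
  | succ k ih =>
    obtain ⟨hs1, hs2⟩ := hs k (by omega)
    obtain ⟨x, T₁, h1, h2, h3, h4⟩ := exists_rskInsert_eq hT.1 hT.nodup (hΛ (2 * k + 1) (by omega))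
      (by rw [hTs]; exact hs2)
    have hn := List.nodup_cons.1 (h4.nodup_iff.1 hT.nodup)
    obtain ⟨T₀, g1, g2, g3, g4⟩ := exists_jdtDelete_eq h1 hn.2 hn.1 (hΛ (2 * k) (by omega))
      (by rw [h2]; exact hs1)
    have hx : 1 ≤ x ∧ x ≤ m := (hT.mem_iff x).1 (h4.mem_iff.2 (by simp))
    obtain ⟨f, f1, f2, f3⟩ := ih (fun t ht => hΛ t (by omega)) (fun j hj => hs j (by omega))
      ⟨g1, g4.trans (h4.symm.trans hT.2)⟩ g2
    have hc : ∀ j < k, Function.update f k x j = f j := fun j hj =>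
      Function.update_of_ne (by omega) _ _
    have e0 : ∀ t ≤ 2 * k, di m (Function.update f k x) t = di m f t := fun t ht => di_congr hc ht
    have e1 : di m (Function.update f k x) (2 * k + 1) = T₁ := by
      rw [di_odd, e0 _ le_rfl, f2, Function.update_self, g3]
    have e2 : di m (Function.update f k x) (2 * k + 2) = T := by
      rw [di_even, e1, Function.update_self, h3]
    refine ⟨Function.update f k x, fun j hj => ?_, e2, fun t ht => ?_⟩
    · rcases Nat.lt_or_ge j k with h | h
      · rw [hc j h]; exact f1 j h
      · obtain rfl : j = k := by omega
        rwa [Function.update_self]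
    · rcases Nat.lt_or_ge (2 * k) t with h | h
      · obtain rfl | rfl : t = 2 * k + 1 ∨ t = 2 * k + 2 := by omega
        · rw [e1, h2]
        · rw [e2, hTs]; rfl
      · rw [e0 t h, f3 t h]

/-- A bump in the first row is recognized by the length of the row. -/
theorem exists_mem_gt_of_headD_length {T : Filling} {x : ℕ} (hT : IsTab T) (hx : x ∉ T.flatten)
    (h : ((rskInsert x T).headD []).length = (T.headD []).length) :
    ∃ y ∈ T.headD [], x < y := by
  cases T with
  | nil => simp [rskInsert] at h
  | cons R Rs =>
    have hx' : x ∉ R := fun h => hx (by rw [List.flatten_cons]; exact List.mem_append_left _ h)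
    rcases append_or_bump hT.2.1 hx' with h1 | ⟨u, y, v, rfl, h1, h2⟩
    · rw [rskInsert_append h1] at h; simp at h
    · exact ⟨y, by simp, h2⟩

theorem length_headD_eq {T : Filling} {a : ℕ} {μ : List ℕ} (h : shape T = a :: μ) :
    (T.headD []).length = a := by
  cases T with
  | nil => simp [shape] at h
  | cons R Rs => exact (List.cons.inj h).1

/-- Every sequence of shapes as in the criterion comes from a stable process: the shapes are
completed by long first rows. -/
theorem exists_stable {k : ℕ} {p : ℕ → List ℕ} (h0 : p 0 = []) (hp : ∀ t, IsPart (p t))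
    (hs : ∀ j < k, (p (2 * j + 1) = p (2 * j) ∨ AddsRow (p (2 * j + 1)) (p (2 * j))) ∧
      AddsRow (p (2 * j + 1)) (p (2 * j + 2))) :
    ∃ m f, 0 < m ∧ Stable m f k ∧ ∀ t ≤ 2 * k, (shape (di m f t)).tail = p t := by
  have hodd : ∀ j < k, (p (2 * j + 1)).sum ≤ (p (2 * j)).sum := by
    intro j hj
    rcases (hs j hj).1 with h | h
    · rw [h]
    · rw [h.sum_eq]; omega
  have heven : ∀ j ≤ k, (p (2 * j)).sum ≤ j := by
    intro j
    induction j with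
    | zero => simp [h0]
    | succ j ih =>
      intro hj
      have h1 := (hs j hj).2.sum_eq
      have h2 := hodd j hj
      have h3 := ih (by omega)
      rw [show 2 * (j + 1) = 2 * j + 2 by ring]; omega
  have hsum : ∀ t ≤ 2 * k, (p t).sum ≤ k := by
    intro t ht
    have h1 := heven (t / 2) (by omega)
    rcases Nat.mod_two_eq_zero_or_one t with h | h
    · rw [show 2 * (t / 2) = t by omega] at h1; omega
    · have h2 := hodd (t / 2) (by omega)
      rw [show 2 * (t / 2) + 1 = t by omega] at h2; omega
  -- a number of boxes for which the first rows exceed the parts of all `p t`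
  obtain ⟨m, hm⟩ : ∃ m, m = 2 * k + 2 := ⟨_, rfl⟩
  obtain ⟨Λ, hΛ⟩ : ∃ Λ : ℕ → List ℕ, ∀ t, Λ t = (m - (p t).sum - t % 2) :: p t := ⟨_, fun _ => rfl⟩
  have hpart : ∀ t ≤ 2 * k, IsPart (Λ t) := by
    intro t ht
    have h1 := hsum t ht
    rw [hΛ]
    refine ⟨List.pairwise_cons.2 ⟨fun a ha => ?_, (hp t).1⟩, fun a ha => ?_⟩
    · have := List.single_le_sum (fun _ _ => Nat.zero_le _) a ha
      omega
    · rcases List.mem_cons.1 ha with rfl | ha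
      · omega
      · exact (hp t).2 a ha
  have hstep : ∀ j < k, AddsRow (Λ (2 * j + 1)) (Λ (2 * j)) ∧
      AddsRow (Λ (2 * j + 1)) (Λ (2 * j + 2)) := by
    intro j hj
    have h1 := hsum (2 * j) (by omega)
    have h2 := hsum (2 * j + 1) (by omega)
    have h3 := hsum (2 * j + 2) (by omega)
    simp only [hΛ]
    refine ⟨?_, ?_⟩
    · rcases (hs j hj).1 with h | h
      · rw [h]
        convert AddsRow.here _ (p (2 * j)) using 2
        omega
      · rw [show m - (p (2 * j + 1)).sum - (2 * j + 1) % 2 = m - (p (2 * j)).sum - 2 * j % 2 by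
          rw [h.sum_eq]; omega]
        exact AddsRow.lower _ h
    · rw [show m - (p (2 * j + 1)).sum - (2 * j + 1) % 2 =
          m - (p (2 * j + 2)).sum - (2 * j + 2) % 2 by rw [(hs j hj).2.sum_eq]; omega]
      exact AddsRow.lower _ (hs j hj).2
  obtain ⟨T, hT, hTs⟩ := exists_isStd (hpart (2 * k) le_rfl) (m := m) (by
    have h1 := hsum (2 * k) le_rfl
    rw [hΛ, List.sum_cons]; omega)
  obtain ⟨f, hf, _, hf2⟩ := exists_di_eq (by rw [hΛ, h0]; simp) hpart hstep hT hTs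
  refine ⟨m, f, by omega, fun j hj => ⟨hf j hj, ?_, ?_⟩, fun t ht => by rw [hf2 t ht, hΛ]; rfl⟩
  · have h1 := hsum (2 * j) (by omega)
    have h2 := hf2 (2 * j) (by omega)
    have h3 := length_second_row_le (di m f (2 * j))
    rw [hΛ] at h2
    rw [length_headD_eq h2]
    rw [h2, List.tail_cons] at h3
    omega
  · have h1 := hf2 (2 * j + 1) (by omega)
    have h2 := hf2 (2 * j + 2) (by omega)
    have h4 := (hs j hj).2.sum_eq
    obtain ⟨g1, _, _, _, g5⟩ := (isStd_di (by omega) hf hj.le).jdtDelete (hf j hj)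
    refine exists_mem_gt_of_headD_length g1 g5 ?_
    rw [← di_odd, ← di_even]
    rw [hΛ] at h1 h2
    rw [length_headD_eq h1, length_headD_eq h2]
    omega

/-! ### Limiting tableaux -/

theorem exists_forall_eq_di {k : ℕ} (i : Fin k → ℕ+) : ∃ f : ℕ → ℕ, (∀ j, (i j : ℕ) = f j) ∧
    ∀ (m : ℕ) (t : Fin (2 * k + 1)), simplifiedTableau m i t = (shape (di m f t)).tail := by
  obtain ⟨f, hf⟩ : ∃ f : ℕ → ℕ, ∀ j : Fin k, (i j : ℕ) = f j :=
    ⟨fun j => if h : j < k then i ⟨j, h⟩ else 0, fun j => by simp⟩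
  refine ⟨f, hf, fun m t => ?_⟩
  rw [simplifiedTableau, vacillatingTableau, diTableau_eq_di hf (by omega)]

/-- If the process for `i` is stable for one `m`, then the limiting tableau of `i` consists of its
shapes below the first row. -/
theorem Stable.isLimitingTableau {m k : ℕ} {f : ℕ → ℕ} {i : Fin k → ℕ+} (hm : 0 < m)
    (h : Stable m f k) (hi : ∀ j, (i j : ℕ) = f j) {P : Fin (2 * k + 1) → YoungDiagram}
    (hP : ∀ t : Fin (2 * k + 1), (P t).rowLens = (shape (di m f t)).tail) :
    IsLimitingTableau i P := by
  intro n hn m' hm' t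
  have h' : Stable m' f k := stable_of_lt (n := n) (fun j hj => by
    rw [← hi ⟨j, hj⟩]; exact ⟨(i _).pos, hn _⟩) hm'
  rw [hP, simplifiedTableau, vacillatingTableau, diTableau_eq_di hi (by omega)]
  have ht : (t : ℕ) ≤ 2 * k := by omega
  rw [← h.tail_shape hm (le_max_left m m') ht, h'.tail_shape (by omega) (le_max_right m m') ht]

/-- Every sequence has a stable process, for an `m` admitted in `IsLimitingTableau`. -/
theorem exists_stable_of_seq {k : ℕ} (i : Fin k → ℕ+) : ∃ n m f, (∀ j, (i j : ℕ) ≤ n) ∧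
    n + 2 * k < m ∧ (∀ j, (i j : ℕ) = f j) ∧ Stable m f k ∧
    ∀ t : Fin (2 * k + 1), simplifiedTableau m i t = (shape (di m f t)).tail := by
  obtain ⟨f, hf, hf2⟩ := exists_forall_eq_di i
  obtain ⟨n, hn⟩ : ∃ n, ∀ j, (i j : ℕ) ≤ n :=
    ⟨Finset.univ.sup fun j => (i j : ℕ), fun j =>
      Finset.le_sup (f := fun j => (i j : ℕ)) (Finset.mem_univ j)⟩
  exact ⟨n, n + 2 * k + 1, f, hn, by omega, hf, stable_of_lt (n := n) (fun j hj => by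
    rw [← hf ⟨j, hj⟩]; exact ⟨(i _).pos, hn _⟩) (by omega), hf2 _⟩

end Vacillating

theorem mainTheorem2 (k : ℕ) :
    (∀ i : Fin k → ℕ+, ∃! P : Fin (2 * k + 1) → YoungDiagram,
      Vacillating.IsLimitingTableau i P) ∧
    ∀ P : Fin (2 * k + 1) → YoungDiagram,
      (∃ i : Fin k → ℕ+, Vacillating.IsLimitingTableau i P) ↔
        P ⟨0, by omega⟩ = ⊥ ∧
        ∀ (j : ℕ) (hj : j < k),
          (P ⟨2 * j + 1, by omega⟩ = P ⟨2 * j, by omega⟩ ∨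
            Vacillating.AddsBox (P ⟨2 * j + 1, by omega⟩) (P ⟨2 * j, by omega⟩)) ∧
          Vacillating.AddsBox (P ⟨2 * j + 1, by omega⟩) (P ⟨2 * j + 2, by omega⟩) := by
  open Vacillating in
  refine ⟨fun i => ?_, fun P => ⟨?_, ?_⟩⟩
  · obtain ⟨n, m, f, hn, hm, hf, hst, hsimp⟩ := exists_stable_of_seq i
    have hm0 : 0 < m := by omega
    have hex : ∀ t : Fin (2 * k + 1), ∃ Y : YoungDiagram,
        Y.rowLens = (shape (di m f t)).tail := by
      intro t
      have htab : IsTab (di m f t) := by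
        have ht := t.2
        obtain h | h : (t : ℕ) % 2 = 0 ∨ (t : ℕ) % 2 = 1 := by omega
        · have := (isStd_di hm0 (fun j hj => (hst j hj).1) (show (t : ℕ) / 2 ≤ k by omega)).1
          rwa [show 2 * ((t : ℕ) / 2) = t by omega] at this
        · have h1 := isStd_di hm0 (fun j hj => (hst j hj).1) (show (t : ℕ) / 2 ≤ k by omega)
          have h2 := (h1.jdtDelete (hst ((t : ℕ) / 2) (by omega)).1).1
          rwa [← di_odd, show 2 * ((t : ℕ) / 2) + 1 = t by omega] at h2
      exact htab.isPart.of_tail.exists_rowLens_eq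
    choose P hP using hex
    refine ⟨P, hst.isLimitingTableau hm0 hf hP, fun Q hQ => funext fun t => ?_⟩
    refine rowLens_injective ?_
    rw [hQ n hn m hm t, hP, hsimp]
  · rintro ⟨i, hi⟩
    obtain ⟨n, m, f, hn, hm, hf, hst, hsimp⟩ := exists_stable_of_seq i
    have hP : ∀ t : Fin (2 * k + 1), (P t).rowLens = (shape (di m f t)).tail := fun t => by
      rw [hi n hn m hm t, hsimp]
    refine ⟨rowLens_injective ?_, fun j hj => ?_⟩
    · rw [hP, rowLens_bot]; simp [di, shape]
    · have hT := isStd_di (by omega) (fun j hj => (hst j hj).1) hj.le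
      obtain ⟨hx, hstep⟩ := hst j hj
      refine ⟨?_, ?_⟩
      · refine (hT.jdtDelete hx).2.2.1.tail.imp (fun h => rowLens_injective ?_) fun h => ?_
        · rw [hP, hP]; simp only [di_odd]; exact h
        · rw [addsBox_iff_addsRow, hP, hP]; simp only [di_odd]; exact h
      · have h := hstep.addsRow_tail hT hx
        rw [← di_odd, ← di_even] at h
        rw [addsBox_iff_addsRow, hP, hP]; exact h
  · rintro ⟨h0, hstep⟩
    let p : ℕ → List ℕ := fun t => if h : t < 2 * k + 1 then (P ⟨t, h⟩).rowLens else []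
    have hp : ∀ t (ht : t < 2 * k + 1), p t = (P ⟨t, ht⟩).rowLens := fun t ht => dif_pos ht
    obtain ⟨m, f, hm, hst, hf⟩ := exists_stable (k := k) (p := p)
      (by rw [hp 0 (by omega), h0, rowLens_bot])
      (fun t => by
        by_cases ht : t < 2 * k + 1
        · rw [hp t ht]; exact isPart_rowLens _
        · rw [show p t = [] from dif_neg ht]; exact ⟨by simp, by simp⟩)
      (fun j hj => by
        obtain ⟨h1, h2⟩ := hstep j hj
        rw [hp (2 * j) (by omega), hp (2 * j + 1) (by omega), hp (2 * j + 2) (by omega)]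
        exact ⟨h1.imp (congrArg _) addsBox_iff_addsRow.1, addsBox_iff_addsRow.1 h2⟩)
    refine ⟨fun j => ⟨f j, (hst j j.2).1.1⟩, hst.isLimitingTableau hm (fun j => rfl) fun t => ?_⟩
    rw [hf t (by omega), hp t t.2]
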